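/- **Setting.** Let $\tau\in i\mathbb{R}_{>0}$, let $l\in\frac12\mathbb{Z}_{>0}$, let $r\ge 1$ and $r'$ be integers, and let $\eta=\frac{r'}{2lr}$ satisfy $\eta\neq 0$ and $|\eta|\le\frac{1}{2(2l+1)}$. Put $$\theta_{ab}(z,\tau)=\sum_{n\in\mathbb{Z}}\exp\Bigl(\pi i\bigl(\tfrac a2+n\bigr)^2\tau+2\pi i\bigl(\tfrac a2+n\bigr)\bigl(\tfrac b2+z\bigr)\Bigr),\qquad [z]=\theta_{11}(z,\tau),$$ $[z]_k=\prod_{j=0}^{k-1}[z+2j\eta]$ and $[z;a]_k=[z+a]_k[-z+a]_k$. Let $\Theta$ be the space of entire functions $f$ with $f(z+1)=f(-z)=f(z)$ and $f(z+\tau)=e^{-4l\pi i(2z+\tau)}f(z)$. The spin $l$ representation $\rho^l$ of the Sklyanin algebra acts on $\Theta$ by $$(\rho^l(S^a)f)(z)=\frac{s_a(z-l\eta)f(z+\eta)-s_a(-z-l\eta)f(z-\eta)}{\theta_{11}(2z,\tau)}\qquad(a=0,1,2,3),$$ $$s_a(z)=\epsilon_a\,\theta_a(\eta)\,\theta_a(2z),\quad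 (\theta_0,\theta_1,\theta_2,\theta_3)=(\theta_{11},\theta_{10},\theta_{00},\theta_{01})(\,\cdot\,,\tau),\quad \epsilon_2=i,\ \epsilon_0=\epsilon_1=\epsilon_3=1.$$ With the Pauli matrices $\sigma^a$ ($\sigma^0=1$), let $$L(u)=\sum_{a=0}^3\frac{\theta_a(u)}{\theta_a(\eta)}\,\rho^l(S^a)\otimes\sigma^a=\bigl(L^{i'}_{j'}(u)\bigr),$$ a $2\times2$ matrix of operators on $\Theta$. Let $N$ be a positive even integer, and let $T(u)=\operatorname{tr}_{\mathbb{C}^2}L_N(u)\cdots L_1(u)$ on $\Theta^{\otimes N}$, where $L_n(u)$ acts as $L(u)$ in the $n$-th tensor factor. **Construction.** Let $$M_\lambda(v)=\begin{pmatrix}-\theta_{00}(\frac{\lambda-v}2,\frac\tau2)&-\theta_{00}(\frac{\lambda+v}2,\frac\tau2)\\ \theta_{01}(\frac{\lambda-v}2,\frac\tau2)&\theta_{01}(\frac{\lambda+v}2,\frac\tau2)\end{pmatrix},\qquad \omega_\lambda(u;v)=\Bigl[z;\tfrac{\lambda+u-v}2+(-l+1)\eta\Bigr]_{2l}\in\Theta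 .$$ Fix $\lambda_0,v\in\mathbb{C}$ with $[v]\ne0$ and $[\lambda_0+4i''l\eta]\neq0$ for $i''=1,\dots,2r$. Put $\tilde M_{i''}=M_{\lambda_0+4i''l\eta}(v)$ and $M=\sum_{i''=1}^{2r}\tilde M_{i''}\otimes E^{i''}_{i''}$ with the $2r\times2r$ matrix units $E^{i''}_{i''}$, and put $X=\operatorname{diag}_{i''=1,\dots,2r}([\lambda_0+4i''l\eta])$. For arbitrary complex parameters $\tau_{kj''}$ ($1\le k\le 2l+1$, $1\le j''\le 2r$) let $S(u)=(S^{i''}_{j''}(u))_{i'',j''=1}^{2r}$ be the matrix of linear maps $\mathbb{C}^{2l+1}\to\Theta$ given on the standard basis $e_1,\dots,e_{2l+1}$ by $$S^{j''\pm1\,(\mathrm{mod}\,2r)}_{j''}(u)\,e_k=\tau_{kj''}\,\omega_{\pm\lambda_0\pm4j''l\eta}(u;\pm v),\qquad S^{i''}_{j''}(u)=0\ \text{ unless } i''\equiv j''\pm1\ (\mathrm{mod}\ 2r).$$ Let $L(u)\otimes S(u)$ be the $4r\times4r$ matrix with entries $L^{i'}_{j'}(u)S^{i''}_{j''}(u)$,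 divided into $2r\times 2r$ blocks according to $(i',j')$, and let $$Q_R(u)=\operatorname{tr}_{\mathbb{C}^{2r}}S_N(u)\cdots S_1(u)=\sum_{i''_1,\dots,i''_N}S^{i''_N}_{i''_{N-1}}(u)\otimes\cdots\otimes S^{i''_2}_{i''_1}(u)\otimes S^{i''_1}_{i''_N}(u):(\mathbb{C}^{2l+1})^{\otimes N}\to\Theta^{\otimes N}.$$ **Claim.** The matrix $M$ is invertible, and for every $u\in\mathbb{C}$ $$M^{-1}(L(u)\otimes S(u))M=\begin{pmatrix}A(u)&*\\0&D(u)\end{pmatrix},\qquad A(u)=2[u+2l\eta]\,S(u-2\eta),\quad D(u)=X^{-1}\bigl(2[u-2l\eta]\,S(u+2\eta)\bigr)X .$$ Moreover $Q_R$ satisfies the $TQ$-relation $$T(u)Q_R(u)=h_-(u)\,Q_R(u-2\eta)+h_+(u)\,Q_R(u+2\eta),\qquad h_\pm(u)=(2[u\mp2l\eta])^N .$$ -/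

import Mathlib

noncomputable section

namespace Sklyanin

open Complex Filter Topology

open UpperHalfPlane hiding I

/-- Theta function with characteristics
`θ_{ab}(z, τ) = ∑_{n ∈ ℤ} exp(π i (a/2 + n)² τ + 2 π i (a/2 + n) (b/2 + z))`. -/
def theta (a b : ℕ) (z τ : ℂ) : ℂ :=
  ∑' n : ℤ, cexp (Real.pi * I * ((a : ℂ) / 2 + n) ^ 2 * τ
    + 2 * Real.pi * I * ((a : ℂ) / 2 + n) * ((b : ℂ) / 2 + z))

/-! ### Basic facts on theta functions -/

lemma theta_eq (a b : ℕ) (z τ : ℂ) :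
    theta a b z τ = cexp (Real.pi * I * ((a : ℂ) / 2) ^ 2 * τ
      + 2 * Real.pi * I * ((a : ℂ) / 2) * ((b : ℂ) / 2 + z))
        * jacobiTheta₂ (z + (b : ℂ) / 2 + (a : ℂ) * τ / 2) τ := by
  rw [theta, jacobiTheta₂, ← tsum_mul_left]
  refine tsum_congr fun n ↦ ?_
  rw [jacobiTheta₂_term, ← Complex.exp_add]
  ring_nf

lemma theta_add_one (a b : ℕ) (z τ : ℂ) :
    theta a b (z + 1) τ = (-1) ^ a * theta a b z τ := by
  rw [theta_eq, theta_eq,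
    show z + 1 + (b : ℂ) / 2 + (a : ℂ) * τ / 2 = (z + (b : ℂ) / 2 + (a : ℂ) * τ / 2) + 1 by ring,
    jacobiTheta₂_add_left, ← mul_assoc, ← Complex.exp_pi_mul_I, ← Complex.exp_nat_mul,
    ← Complex.exp_add]
  ring_nf

lemma theta_add_tau (a b : ℕ) (z τ : ℂ) :
    theta a b (z + τ) τ
      = (-1) ^ b * cexp (-(Real.pi * I * (τ + 2 * z))) * theta a b z τ := by
  have h : ((-1 : ℂ)) ^ b = cexp (-(b * (Real.pi * I))) := by
    rw [Complex.exp_neg, Complex.exp_nat_mul, Complex.exp_pi_mul_I, ← inv_pow]; norm_num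
  rw [theta_eq, theta_eq,
    show z + τ + (b : ℂ) / 2 + (a : ℂ) * τ / 2 = (z + (b : ℂ) / 2 + (a : ℂ) * τ / 2) + τ by ring,
    jacobiTheta₂_add_left', h, ← mul_assoc, ← mul_assoc, ← Complex.exp_add, ← Complex.exp_add,
    ← Complex.exp_add]
  ring_nf

lemma theta_add_two (a b : ℕ) (z τ : ℂ) : theta a b (z + 2) τ = theta a b z τ := by
  rw [show z + 2 = z + 1 + 1 by ring, theta_add_one, theta_add_one, ← mul_assoc, ← mul_pow]
  norm_num

lemma theta_add_two_tau (a b : ℕ) (z τ : ℂ) :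
    theta a b (z + 2 * τ) τ
      = cexp (-(4 * Real.pi * I * (τ + z))) * theta a b z τ := by
  have h : ((-1 : ℂ)) ^ b * (-1) ^ b = 1 := by rw [← mul_pow]; norm_num
  rw [show z + 2 * τ = z + τ + τ by ring, theta_add_tau, theta_add_tau,
    show ∀ x y w t : ℂ, w * x * (w * y * t) = (w * w) * (x * y) * t from fun _ _ _ _ ↦ by ring,
    h, ← Complex.exp_add, one_mul]
  ring_nf

lemma theta_one_one_neg (z τ : ℂ) : theta 1 1 (-z) τ = -theta 1 1 z τ := by
  rw [theta_eq, theta_eq, ← jacobiTheta₂_neg_left,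
    show z + ((1 : ℕ) : ℂ) / 2 + ((1 : ℕ) : ℂ) * τ / 2
      = -(-z + ((1 : ℕ) : ℂ) / 2 + ((1 : ℕ) : ℂ) * τ / 2) + 1 + τ by push_cast; ring,
    jacobiTheta₂_add_left', jacobiTheta₂_add_left, ← mul_assoc, ← Complex.exp_add, ← neg_mul,
    neg_eq_neg_one_mul (cexp _), ← Complex.exp_pi_mul_I, ← Complex.exp_add]
  congr 1
  rw [Complex.exp_eq_exp_iff_exists_int]
  refine ⟨0, ?_⟩
  push_cast
  ring

lemma differentiable_theta (a b : ℕ) (τ : ℍ) : Differentiable ℂ fun z ↦ theta a b z τ := by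
  have h : (fun z ↦ theta a b z τ) = fun z ↦ cexp (Real.pi * I * ((a : ℂ) / 2) ^ 2 * τ
      + 2 * Real.pi * I * ((a : ℂ) / 2) * ((b : ℂ) / 2 + z))
        * jacobiTheta₂ (z + (b : ℂ) / 2 + (a : ℂ) * τ / 2) τ := funext fun z ↦ theta_eq a b z τ
  rw [h]
  intro z
  refine DifferentiableAt.mul (by fun_prop) ?_
  exact DifferentiableAt.comp (g := fun w ↦ jacobiTheta₂ w τ) z
    (differentiableAt_jacobiTheta₂_fst _ τ.im_pos) (by fun_prop)

lemma exists_theta_ne_zero (τ : ℍ) : ∃ z, theta 1 1 z τ ≠ 0 := by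
  by_contra! h
  have h0 : ∀ z, jacobiTheta₂ z τ = 0 := by
    intro z
    have := h (z - ((1 : ℕ) : ℂ) / 2 - ((1 : ℕ) : ℂ) * τ / 2)
    rw [theta_eq] at this
    rcases mul_eq_zero.1 this with h1 | h1
    · exact absurd h1 (Complex.exp_ne_zero _)
    · rw [← h1]; congr 1; ring
  have hs : HasSum (fun n : ℤ ↦ ∫ x in (0 : ℝ)..1, jacobiTheta₂_term n x τ)
      (∫ x in (0 : ℝ)..1, jacobiTheta₂ x τ) := by
    have hsum : Summable fun n : ℤ ↦ ‖jacobiTheta₂_term n 0 τ‖ :=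
      ((summable_jacobiTheta₂_term_iff 0 τ).2 τ.im_pos).norm
    refine intervalIntegral.hasSum_integral_of_dominated_convergence
      (fun n _ ↦ ‖jacobiTheta₂_term n 0 τ‖) (fun n ↦ ?_) (fun n ↦ ?_) ?_ ?_ ?_
    · refine Continuous.aestronglyMeasurable ?_
      unfold jacobiTheta₂_term
      fun_prop
    · refine Eventually.of_forall fun x _ ↦ ?_
      rw [norm_jacobiTheta₂_term, norm_jacobiTheta₂_term]
      simp
    · exact Eventually.of_forall fun x _ ↦ hsum
    · exact intervalIntegrable_const
    · exact Eventually.of_forall fun x _ ↦ hasSum_jacobiTheta₂_term x τ.im_pos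
  have h2 : ∀ n : ℤ, n ≠ 0 → ∫ x in (0 : ℝ)..1, jacobiTheta₂_term n x τ = 0 := by
    intro n hn
    have hc : (2 * Real.pi * I * n : ℂ) ≠ 0 := by
      simp [hn, Real.pi_ne_zero]
    simp_rw [jacobiTheta₂_term, Complex.exp_add]
    rw [intervalIntegral.integral_mul_const, integral_exp_mul_complex hc]
    have : cexp (2 * Real.pi * I * n * ((1 : ℝ) : ℂ)) = 1 := by
      rw [Complex.exp_eq_one_iff]
      exact ⟨n, by push_cast; ring⟩
    rw [this]; simp
  have h3 := hs.unique (hasSum_single 0 fun n hn ↦ h2 n hn)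
  simp [h0, jacobiTheta₂_term] at h3

/-! ### The zeros of `θ₁₁` and division by `θ₁₁` -/

lemma entire_cancel {A F G : ℂ → ℂ} (hA : Differentiable ℂ A) (hF : Differentiable ℂ F)
    (hG : Differentiable ℂ G) (hA0 : ∃ z, A z ≠ 0) (h : ∀ z, A z * F z = A z * G z) : F = G := by
  have h1 := AnalyticOnNhd.eq_zero_or_eq_zero_of_mul_eq_zero (U := Set.univ)
    (f := A) (g := fun z ↦ F z - G z)
    (fun z _ ↦ hA.analyticAt z) (fun z _ ↦ (hF.sub hG).analyticAt z)
    (fun z _ ↦ by rw [mul_sub, h z, sub_self]) isPreconnected_univ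
  obtain ⟨z₀, hz₀⟩ := hA0
  rcases h1 with h1 | h1
  · exact absurd (h1 z₀ trivial) hz₀
  · exact funext fun z ↦ sub_eq_zero.1 (h1 z trivial)

lemma entire_div {G N : ℂ → ℂ} (hG : Differentiable ℂ G) (hN : Differentiable ℂ N)
    (hs : ∀ z, G z = 0 → deriv G z ≠ 0) (h0 : ∀ z, G z = 0 → N z = 0) :
    ∃ g : ℂ → ℂ, Differentiable ℂ g ∧ ∀ z, N z = G z * g z := by
  classical
  refine ⟨fun z ↦ if G z = 0 then deriv N z / deriv G z else N z / G z, fun p ↦ ?_, fun z ↦ ?_⟩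
  · by_cases hp : G p = 0
    · have hd : DifferentiableAt ℂ (fun z ↦ dslope N p z / dslope G p z) p := by
        have hu : (Set.univ : Set ℂ) ∈ 𝓝 p := univ_mem
        refine DifferentiableAt.div ?_ ?_ (by rw [dslope_same]; exact hs p hp)
        · exact ((differentiableOn_dslope hu).2 hN.differentiableOn).differentiableAt hu
        · exact ((differentiableOn_dslope hu).2 hG.differentiableOn).differentiableAt hu
      refine hd.congr_of_eventuallyEq ?_
      have hc : ContinuousAt (dslope G p) p := continuousAt_dslope_same.2 (hG p)
      have hne : ∀ᶠ z in 𝓝 p, dslope G p z ≠ 0 :=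
        hc.eventually_ne (by rw [dslope_same]; exact hs p hp)
      filter_upwards [hne] with z hz
      by_cases hzp : z = p
      · subst hzp; simp [hp, dslope_same]
      · have e1 := sub_smul_dslope G p z
        have e2 := sub_smul_dslope N p z
        rw [hp, sub_zero, smul_eq_mul] at e1
        rw [h0 p hp, sub_zero, smul_eq_mul] at e2
        have hzp' : z - p ≠ 0 := sub_ne_zero.2 hzp
        have hGz : G z ≠ 0 := by rw [← e1]; exact mul_ne_zero hzp' hz
        rw [if_neg hGz, ← e1, ← e2, mul_div_mul_left _ _ hzp']
    · have hd : DifferentiableAt ℂ (fun z ↦ N z / G z) p := (hN p).div (hG p) hp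
      refine hd.congr_of_eventuallyEq ?_
      filter_upwards [(hG p).continuousAt.eventually_ne hp] with z hz
      rw [if_neg hz]
  · by_cases hz : G z = 0
    · simp [hz, h0 z hz]
    · simp [hz, mul_div_cancel₀]

/-- The function `f` is multiplied by a nowhere vanishing entire function under `z ↦ z + p`. -/
def QuasiPeriod (f : ℂ → ℂ) (p : ℂ) : Prop :=
  ∃ u : ℂ → ℂ, Differentiable ℂ u ∧ (∀ z, u z ≠ 0) ∧ ∀ z, f (z + p) = u z * f z

lemma quasiPeriod_lattice {f : ℂ → ℂ} {p q : ℂ} (hp : QuasiPeriod f p) (hq : QuasiPeriod f q)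
    (m n : ℤ) : QuasiPeriod f (m * p + n * q) := by
  let H : AddSubgroup ℂ :=
    { carrier := {p | QuasiPeriod f p}
      zero_mem' := ⟨fun _ ↦ 1, by fun_prop, by simp, by simp⟩
      add_mem' := by
        rintro a b ⟨u, hu, hu0, hu1⟩ ⟨v, hv, hv0, hv1⟩
        refine ⟨fun z ↦ v (z + a) * u z, by fun_prop, fun z ↦ mul_ne_zero (hv0 _) (hu0 _),
          fun z ↦ ?_⟩
        rw [← add_assoc, hv1, hu1, mul_assoc]
      neg_mem' := by
        rintro a ⟨u, hu, hu0, hu1⟩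
        refine ⟨fun z ↦ (u (z + -a))⁻¹, ?_, fun z ↦ inv_ne_zero (hu0 _), fun z ↦ ?_⟩
        · exact Differentiable.inv (by fun_prop) fun z ↦ hu0 _
        · have := hu1 (z + -a)
          rw [neg_add_cancel_right] at this
          rw [this, inv_mul_cancel_left₀ (hu0 _)] }
  have h1 : m • p + n • q ∈ H := H.add_mem (H.zsmul_mem hp m) (H.zsmul_mem hq n)
  rw [zsmul_eq_mul, zsmul_eq_mul] at h1
  exact h1

/-- The product `∏_{k ≥ 0} (1 - Q^k x)`. -/
def qProd (Q x : ℂ) : ℂ := ∏' k : ℕ, (1 + -(Q ^ k * x))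

lemma summable_qProd {Q : ℂ} (hQ : ‖Q‖ < 1) (x : ℂ) : Summable fun k : ℕ ↦ ‖-(Q ^ k * x)‖ := by
  simp_rw [norm_neg, norm_mul, norm_pow]
  exact (summable_geometric_of_lt_one (norm_nonneg _) hQ).mul_right ‖x‖

lemma qProd_eq {Q : ℂ} (hQ : ‖Q‖ < 1) (x : ℂ) : qProd Q x = (1 - x) * qProd Q (Q * x) := by
  let f : ℕ → ℂ := fun k ↦ 1 + -(Q ^ k * x)
  have hf : ∀ k, f (k + 1) = 1 + -(Q ^ k * (Q * x)) := fun k ↦ by simp only [f]; ring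
  have hm : Multipliable fun k ↦ f (k + 1) := by
    rw [funext hf]
    exact multipliable_one_add_of_summable (summable_qProd hQ (Q * x))
  have h1 : qProd Q x = f 0 * ∏' k, f (k + 1) := tprod_eq_zero_mul' hm
  have h2 : f 0 = 1 - x := by simp only [f]; ring
  rw [h1, h2, tprod_congr hf, qProd]

lemma qProd_ne_zero {Q : ℂ} (hQ : ‖Q‖ < 1) {x : ℂ} (hx : ∀ k : ℕ, Q ^ k * x ≠ 1) :
    qProd Q x ≠ 0 := by
  refine tprod_one_add_ne_zero_of_summable (fun k h ↦ hx k ?_) (summable_qProd hQ x)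
  linear_combination -h

lemma differentiable_qProd {Q : ℂ} (hQ : ‖Q‖ < 1) : Differentiable ℂ (qProd Q) := by
  intro x
  have h := Summable.hasProdLocallyUniformlyOn_nat_one_add (R := ℂ) (α := ℂ)
    (f := fun k x ↦ -(Q ^ k * x)) (K := Metric.ball 0 (‖x‖ + 1)) (u := fun k ↦ ‖Q‖ ^ k * (‖x‖ + 1))
    Metric.isOpen_ball ((summable_geometric_of_lt_one (norm_nonneg _) hQ).mul_right _)
    (Eventually.of_forall fun k y hy ↦ by
      have : ‖y‖ < ‖x‖ + 1 := by simpa using hy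
      rw [norm_neg, norm_mul, norm_pow]
      gcongr) (fun k ↦ by fun_prop)
  refine (h.differentiableOn (.of_forall fun s ↦ ?_) Metric.isOpen_ball).differentiableAt
    (Metric.isOpen_ball.mem_nhds (by simp))
  simpa [Finset.prod_fn] using DifferentiableOn.finsetProd (fun _ _ ↦ by fun_prop)

/-- A product with simple zeros exactly on the lattice `ℤ + τ ℤ`. -/
def thetaProd (τ : ℍ) (z : ℂ) : ℂ :=
  cexp (Real.pi * I * z) *
    (qProd (cexp (2 * Real.pi * I * τ)) (cexp (2 * Real.pi * I * (τ + z))) *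
      qProd (cexp (2 * Real.pi * I * τ)) (cexp (-(2 * Real.pi * I * z))))

lemma norm_q_lt_one (τ : ℍ) : ‖cexp (2 * Real.pi * I * τ)‖ < 1 :=
  norm_exp_two_pi_I_lt_one τ

lemma differentiable_thetaProd (τ : ℍ) : Differentiable ℂ (thetaProd τ) := by
  have h := differentiable_qProd (norm_q_lt_one τ)
  have h1 : Differentiable ℂ fun z : ℂ ↦
      qProd (cexp (2 * Real.pi * I * τ)) (cexp (2 * Real.pi * I * (τ + z))) :=
    h.comp (f := fun z : ℂ ↦ cexp (2 * Real.pi * I * (τ + z))) (by fun_prop)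
  have h2 : Differentiable ℂ fun z : ℂ ↦
      qProd (cexp (2 * Real.pi * I * τ)) (cexp (-(2 * Real.pi * I * z))) :=
    h.comp (f := fun z : ℂ ↦ cexp (-(2 * Real.pi * I * z))) (by fun_prop)
  unfold thetaProd
  fun_prop

lemma thetaProd_add_one (τ : ℍ) (z : ℂ) : thetaProd τ (z + 1) = -1 * thetaProd τ z := by
  have h1 : cexp (2 * Real.pi * I * (τ + (z + 1))) = cexp (2 * Real.pi * I * (τ + z)) := by
    rw [Complex.exp_eq_exp_iff_exists_int]; exact ⟨1, by push_cast; ring⟩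
  have h2 : cexp (-(2 * Real.pi * I * (z + 1))) = cexp (-(2 * Real.pi * I * z)) := by
    rw [Complex.exp_eq_exp_iff_exists_int]; exact ⟨-1, by push_cast; ring⟩
  have h3 : cexp (Real.pi * I * (z + 1)) = -1 * cexp (Real.pi * I * z) := by
    rw [mul_add, Complex.exp_add, mul_one, Complex.exp_pi_mul_I, mul_comm]
  rw [thetaProd, h1, h2, h3, thetaProd, mul_assoc]

lemma thetaProd_add_tau (τ : ℍ) (z : ℂ) :
    thetaProd τ (z + τ) = -cexp (-(Real.pi * I * (τ + 2 * z))) * thetaProd τ z := by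
  have e1 := qProd_eq (norm_q_lt_one τ) (cexp (2 * Real.pi * I * (τ + z)))
  have e2 := qProd_eq (norm_q_lt_one τ) (cexp (-(2 * Real.pi * I * (z + τ))))
  rw [← Complex.exp_add] at e1 e2
  rw [show 2 * Real.pi * I * τ + 2 * Real.pi * I * (τ + z) = 2 * Real.pi * I * (τ + (z + τ)) by
    ring] at e1
  rw [show 2 * Real.pi * I * (τ : ℂ) + -(2 * Real.pi * I * (z + τ)) = -(2 * Real.pi * I * z) by
    ring] at e2
  rw [thetaProd, thetaProd, e1, e2]
  have key : cexp (Real.pi * I * (z + τ)) * (1 - cexp (-(2 * Real.pi * I * (z + τ))))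
      = -cexp (-(Real.pi * I * (τ + 2 * z))) * cexp (Real.pi * I * z)
        * (1 - cexp (2 * Real.pi * I * (τ + z))) := by
    rw [mul_sub, mul_sub, mul_one, mul_one, neg_mul, neg_mul, ← Complex.exp_add, ← Complex.exp_add,
      ← Complex.exp_add]
    ring_nf
  linear_combination (qProd (cexp (2 * Real.pi * I * τ)) (cexp (2 * Real.pi * I * (τ + (z + τ))))
    * qProd (cexp (2 * Real.pi * I * τ)) (cexp (-(2 * Real.pi * I * z)))) * key

lemma thetaProd_quasiPeriod (τ : ℍ) (m n : ℤ) : QuasiPeriod (thetaProd τ) (m + n * τ) := by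
  have := quasiPeriod_lattice (f := thetaProd τ) (p := 1) (q := τ)
    ⟨fun _ ↦ -1, by fun_prop, by simp, fun z ↦ thetaProd_add_one τ z⟩
    ⟨fun z ↦ -cexp (-(Real.pi * I * (τ + 2 * z))), by fun_prop, by simp,
      fun z ↦ thetaProd_add_tau τ z⟩ m n
  rwa [mul_one] at this

lemma qProd_q_ne_zero {Q : ℂ} (hQ : ‖Q‖ < 1) : qProd Q Q ≠ 0 := by
  refine qProd_ne_zero hQ fun k h ↦ ?_
  rw [← pow_succ] at h
  have : ‖Q‖ ^ (k + 1) < 1 := pow_lt_one₀ (norm_nonneg _) hQ (by omega)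
  rw [← norm_pow, h, norm_one] at this
  exact lt_irrefl _ this

lemma deriv_thetaProd_zero (τ : ℍ) : thetaProd τ 0 = 0 ∧ deriv (thetaProd τ) 0 ≠ 0 := by
  have hQ := norm_q_lt_one τ
  set Q := cexp (2 * Real.pi * I * τ) with hQd
  let H : ℂ → ℂ := fun z ↦ cexp (Real.pi * I * z) *
    (qProd Q (cexp (2 * Real.pi * I * (τ + z))) * qProd Q (Q * cexp (-(2 * Real.pi * I * z))))
  have hfac : thetaProd τ = fun z ↦ (1 - cexp (-(2 * Real.pi * I * z))) * H z := by
    funext z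
    rw [thetaProd, ← hQd, qProd_eq hQ (cexp (-(2 * Real.pi * I * z)))]
    simp only [H]
    ring
  have hq := differentiable_qProd hQ
  have hH : Differentiable ℂ H := by
    have h1 : Differentiable ℂ fun z : ℂ ↦ qProd Q (cexp (2 * Real.pi * I * (τ + z))) :=
      hq.comp (f := fun z : ℂ ↦ cexp (2 * Real.pi * I * (τ + z))) (by fun_prop)
    have h2 : Differentiable ℂ fun z : ℂ ↦ qProd Q (Q * cexp (-(2 * Real.pi * I * z))) :=
      hq.comp (f := fun z : ℂ ↦ Q * cexp (-(2 * Real.pi * I * z))) (by fun_prop)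
    simp only [H]
    fun_prop
  have hH0 : H 0 ≠ 0 := by
    simp only [H, mul_zero, add_zero, neg_zero, Complex.exp_zero, mul_one, one_mul, ← hQd]
    exact mul_ne_zero (qProd_q_ne_zero hQ) (qProd_q_ne_zero hQ)
  have hd : HasDerivAt (fun z : ℂ ↦ 1 - cexp (-(2 * Real.pi * I * z))) (2 * Real.pi * I) 0 := by
    have h1 : HasDerivAt (fun z : ℂ ↦ -(2 * Real.pi * I * z)) (-(2 * Real.pi * I)) 0 := by
      refine HasDerivAt.congr_deriv (f' := -(2 * Real.pi * I * 1)) ?_ (by ring)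
      exact ((hasDerivAt_id (0 : ℂ)).const_mul (2 * Real.pi * I)).neg
    have h2 := (h1.cexp).const_sub 1
    simpa using h2
  have hd2 := hd.mul (hH 0).hasDerivAt
  have hd3 : HasDerivAt (thetaProd τ) (2 * Real.pi * I * H 0) 0 := by
    rw [hfac]
    simpa [Pi.mul_def] using hd2
  refine ⟨by rw [hfac]; simp, ?_⟩
  rw [hd3.deriv]
  exact mul_ne_zero (by simp [Real.pi_ne_zero]) hH0

lemma thetaProd_lattice (τ : ℍ) (m n : ℤ) :
    thetaProd τ (m + n * τ) = 0 ∧ deriv (thetaProd τ) (m + n * τ) ≠ 0 := by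
  obtain ⟨u, hu, hu0, hu1⟩ := thetaProd_quasiPeriod τ m n
  obtain ⟨h0, h1⟩ := deriv_thetaProd_zero τ
  refine ⟨by rw [← zero_add (m + n * τ : ℂ), hu1, h0, mul_zero], ?_⟩
  have hG := differentiable_thetaProd τ
  have e1 : deriv (fun z ↦ thetaProd τ (z + (m + n * τ))) 0
      = deriv (thetaProd τ) (m + n * τ) := by
    rw [deriv_comp_add_const, zero_add]
  have e2 : deriv (fun z ↦ thetaProd τ (z + (m + n * τ))) 0
      = u 0 * deriv (thetaProd τ) 0 := by
    rw [funext hu1, deriv_fun_mul (hu 0) (hG 0), h0, mul_zero, zero_add]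
  rw [← e1, e2]
  exact mul_ne_zero (hu0 0) h1

lemma thetaProd_eq_zero {τ : ℍ} {z : ℂ} (h : thetaProd τ z = 0) :
    ∃ m n : ℤ, z = m + n * τ := by
  have hQ := norm_q_lt_one τ
  by_contra! hz
  refine mul_ne_zero (Complex.exp_ne_zero _) (mul_ne_zero ?_ ?_) h
  · refine qProd_ne_zero hQ fun k hk ↦ ?_
    rw [← Complex.exp_nat_mul, ← Complex.exp_add, Complex.exp_eq_one_iff] at hk
    obtain ⟨m, hm⟩ := hk
    refine hz m (-(k + 1)) ?_
    have hpi : (2 * Real.pi * I : ℂ) ≠ 0 := by simp [Real.pi_ne_zero]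
    apply mul_left_cancel₀ hpi
    push_cast
    linear_combination hm
  · refine qProd_ne_zero hQ fun k hk ↦ ?_
    rw [← Complex.exp_nat_mul, ← Complex.exp_add, Complex.exp_eq_one_iff] at hk
    obtain ⟨m, hm⟩ := hk
    refine hz (-m) k ?_
    have hpi : (2 * Real.pi * I : ℂ) ≠ 0 := by simp [Real.pi_ne_zero]
    apply mul_left_cancel₀ hpi
    push_cast
    linear_combination -hm

/-- An entire function vanishing on the lattice is divisible by `thetaProd`. -/
lemma thetaProd_dvd (τ : ℍ) {N : ℂ → ℂ} (hN : Differentiable ℂ N)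
    (h0 : ∀ m n : ℤ, N (m + n * τ) = 0) :
    ∃ g : ℂ → ℂ, Differentiable ℂ g ∧ ∀ z, N z = thetaProd τ z * g z := by
  refine entire_div (differentiable_thetaProd τ) hN (fun z hz ↦ ?_) fun z hz ↦ ?_
  · obtain ⟨m, n, rfl⟩ := thetaProd_eq_zero hz
    exact (thetaProd_lattice τ m n).2
  · obtain ⟨m, n, rfl⟩ := thetaProd_eq_zero hz
    exact h0 m n

lemma theta_one_one_lattice (τ : ℍ) (m n : ℤ) : theta 1 1 (m + n * τ) τ = 0 := by
  have h0 : theta 1 1 0 τ = 0 := by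
    have := theta_one_one_neg 0 τ
    rw [neg_zero] at this
    linear_combination this / 2
  have hq := quasiPeriod_lattice (f := fun z ↦ theta 1 1 z τ) (p := 1) (q := τ)
    ⟨fun _ ↦ (-1) ^ 1, by fun_prop, by simp, fun z ↦ theta_add_one 1 1 z τ⟩
    ⟨fun z ↦ (-1) ^ 1 * cexp (-(Real.pi * I * (τ + 2 * z))), by fun_prop, by simp,
      fun z ↦ theta_add_tau 1 1 z τ⟩ m n
  obtain ⟨u, -, -, hu⟩ := hq
  have := hu 0
  simp only [zero_add, mul_one, h0, mul_zero] at this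
  exact this

lemma theta_eq_thetaProd (τ : ℍ) : ∃ c : ℂ, c ≠ 0 ∧ ∀ z, theta 1 1 z τ = c * thetaProd τ z := by
  obtain ⟨g, hg, hgz⟩ := thetaProd_dvd τ (differentiable_theta 1 1 τ) (theta_one_one_lattice τ)
  obtain ⟨z₀, hz₀⟩ := exists_theta_ne_zero τ
  have hG := differentiable_thetaProd τ
  have hG0 : ∃ z, thetaProd τ z ≠ 0 := ⟨z₀, fun h ↦ hz₀ (by rw [hgz, h, zero_mul])⟩
  have p1 : ∀ z, g (z + 1) = g z := by
    refine congrFun (entire_cancel (A := thetaProd τ) (F := fun z ↦ g (z + 1)) (G := g) hG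
      (by fun_prop) hg hG0 fun z ↦ ?_)
    have := hgz (z + 1)
    rw [theta_add_one, thetaProd_add_one, hgz] at this
    linear_combination this
  have p2 : ∀ z, g (z + τ) = g z := by
    refine congrFun (entire_cancel (A := thetaProd τ) (F := fun z ↦ g (z + τ)) (G := g) hG
      (by fun_prop) hg hG0 fun z ↦ ?_)
    have := hgz (z + τ)
    rw [theta_add_tau, thetaProd_add_tau, hgz, pow_one, neg_one_mul, mul_assoc, mul_assoc] at this
    exact (mul_left_cancel₀ (neg_ne_zero.2 (Complex.exp_ne_zero _)) this).symm
  let L : PeriodPair := ⟨1, τ, by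
    rw [LinearIndependent.pair_iff]
    intro s t h
    have him := congrArg Complex.im h
    have hre := congrArg Complex.re h
    simp at him hre
    rcases him with h1 | h1
    · subst h1; simpa using hre
    · exact absurd h1 τ.im_ne_zero⟩
  have hper : ∀ z w, w ∈ L.lattice → g (z + w) = g z := by
    intro z w hw
    obtain ⟨m, n, rfl⟩ := PeriodPair.mem_lattice.1 hw
    have q1 : Function.Periodic g 1 := p1
    have q2 : Function.Periodic g (τ : ℂ) := p2
    rw [← add_assoc]
    change g (z + m * 1 + n * τ) = g z
    rw [(q2.int_mul n) _, (q1.int_mul m) _]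
  obtain ⟨c, hc⟩ := hg.exists_const_forall_eq_of_bounded
    (IsZLattice.isCompact_range_of_periodic L.lattice g hg.continuous hper).isBounded
  refine ⟨c, fun h ↦ hz₀ ?_, fun z ↦ by rw [hgz, hc, mul_comm]⟩
  rw [hgz, hc, h, mul_zero]

/-- An entire function vanishing on the lattice `ℤ + τ ℤ` is divisible by `θ₁₁`. -/
lemma theta_dvd (τ : ℍ) {N : ℂ → ℂ} (hN : Differentiable ℂ N)
    (h0 : ∀ m n : ℤ, N (m + n * τ) = 0) :
    ∃ g : ℂ → ℂ, Differentiable ℂ g ∧ ∀ z, theta 1 1 z τ * g z = N z := by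
  obtain ⟨c, hc, hcz⟩ := theta_eq_thetaProd τ
  obtain ⟨g, hg, hgz⟩ := thetaProd_dvd τ hN h0
  refine ⟨fun z ↦ c⁻¹ * g z, by fun_prop, fun z ↦ ?_⟩
  rw [hcz, hgz]
  field_simp

/-! ### Theta functions of the model and the Sklyanin algebra -/

/-- The odd theta function `[z] = θ₁₁(z, τ)`. -/
def br (τ : ℍ) (z : ℂ) : ℂ := theta 1 1 z τ

/-- `[z]_k = ∏_{j < k} [z + 2jη]`. -/
def brProd (η : ℂ) (τ : ℍ) (k : ℕ) (z : ℂ) : ℂ := ∏ j ∈ Finset.range k, br τ (z + 2 * j * η)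

/-- `[z; a]_k = [z + a]_k [-z + a]_k`. -/
def brPair (η : ℂ) (τ : ℍ) (k : ℕ) (a z : ℂ) : ℂ := brProd η τ k (z + a) * brProd η τ k (-z + a)

/-- The theta functions `θ₁₁, θ₁₀, θ₀₀, θ₀₁` attached to the indices `0, 1, 2, 3`. -/
def thetaIdx (τ : ℍ) (a : Fin 4) (z : ℂ) : ℂ :=
  theta (![1, 1, 0, 0] a) (![1, 0, 0, 1] a) z τ

/-- The space `Θ₀₀^{4l+}`, where `twoL = 2l`: even entire functions with
`f (z + 1) = f z` and `f (z + τ) = exp (-4 l π i (2 z + τ)) f z`. -/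
def thetaSpace (twoL : ℕ) (τ : ℍ) : Submodule ℂ (ℂ → ℂ) where
  carrier := {f | Differentiable ℂ f ∧ (∀ z, f (z + 1) = f z) ∧ (∀ z, f (-z) = f z) ∧
    ∀ z, f (z + τ) = cexp (-(2 * twoL * Real.pi * I * (2 * z + τ))) * f z}
  zero_mem' := ⟨differentiable_const 0, by simp, by simp, by simp⟩
  add_mem' := by
    rintro f g ⟨hf, hf1, hf2, hf3⟩ ⟨hg, hg1, hg2, hg3⟩
    refine ⟨hf.add hg, fun z ↦ ?_, fun z ↦ ?_, fun z ↦ ?_⟩ <;> simp only [Pi.add_apply]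
    · rw [hf1, hg1]
    · rw [hf2, hg2]
    · rw [hf3, hg3]; ring
  smul_mem' := by
    rintro c f ⟨hf, hf1, hf2, hf3⟩
    refine ⟨hf.const_smul c, fun z ↦ ?_, fun z ↦ ?_, fun z ↦ ?_⟩ <;>
      simp only [Pi.smul_apply, smul_eq_mul]
    · rw [hf1]
    · rw [hf2]
    · rw [hf3]; ring

/-- The coefficient functions `s_a` of the difference operators: `s_a(z) = θ_a(η) θ_a(2z)` for
`a = 0, 1, 3` and `s_2(z) = i θ₀₀(η) θ₀₀(2z)`. -/
def sCoeff (η : ℂ) (τ : ℍ) (a : Fin 4) (z : ℂ) : ℂ :=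
  (if a = 2 then I else 1) * thetaIdx τ a η * thetaIdx τ a (2 * z)

/-- The numerator `s_a(z - lη) f(z + η) - s_a(-z - lη) f(z - η)` of `(ρ^l(S^a) f)(z)`. -/
def sNum (twoL : ℕ) (η : ℂ) (τ : ℍ) (a : Fin 4) (f : ℂ → ℂ) (z : ℂ) : ℂ :=
  sCoeff η τ a (z - twoL / 2 * η) * f (z + η) - sCoeff η τ a (-z - twoL / 2 * η) * f (z - η)

section Generators

variable {twoL : ℕ} {η : ℂ} {τ : ℍ} {a : Fin 4} {f : ℂ → ℂ}

lemma differentiable_thetaIdx : Differentiable ℂ (thetaIdx τ a) := differentiable_theta _ _ τ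

lemma differentiable_sNum (hf : f ∈ thetaSpace twoL τ) :
    Differentiable ℂ (sNum twoL η τ a f) := by
  have h1 : Differentiable ℂ f := hf.1
  have h2 : Differentiable ℂ (thetaIdx τ a) := differentiable_thetaIdx
  unfold sNum sCoeff
  fun_prop

lemma sNum_neg (hf : f ∈ thetaSpace twoL τ) (z : ℂ) :
    sNum twoL η τ a f (-z) = -sNum twoL η τ a f z := by
  have h1 : f (-z + η) = f (z - η) := by rw [← hf.2.2.1]; ring_nf
  have h2 : f (-z - η) = f (z + η) := by rw [← hf.2.2.1]; ring_nf
  rw [sNum, sNum, h1, h2, neg_neg]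
  ring

lemma sCoeff_add_one (z : ℂ) : sCoeff η τ a (z + 1) = sCoeff η τ a z := by
  rw [sCoeff, sCoeff, thetaIdx, thetaIdx, mul_add, mul_one, theta_add_two]
  rfl

lemma sCoeff_add_tau (z : ℂ) :
    sCoeff η τ a (z + τ) = cexp (-(4 * Real.pi * I * (τ + 2 * z))) * sCoeff η τ a z := by
  have h : thetaIdx τ a (2 * (z + τ))
      = cexp (-(4 * Real.pi * I * (τ + 2 * z))) * thetaIdx τ a (2 * z) := by
    rw [thetaIdx, thetaIdx, mul_add, theta_add_two_tau]
  rw [sCoeff, sCoeff, h]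
  ring

lemma sNum_add_one (hf : f ∈ thetaSpace twoL τ) (z : ℂ) :
    sNum twoL η τ a f (z + 1) = sNum twoL η τ a f z := by
  have h1 : f (z + 1 + η) = f (z + η) := by rw [← hf.2.1 (z + η)]; ring_nf
  have h2 : f (z + 1 - η) = f (z - η) := by rw [← hf.2.1 (z - η)]; ring_nf
  have h3 : sCoeff η τ a (z + 1 - twoL / 2 * η) = sCoeff η τ a (z - twoL / 2 * η) := by
    rw [← sCoeff_add_one (z - twoL / 2 * η)]; ring_nf
  have h4 : sCoeff η τ a (-(z + 1) - twoL / 2 * η) = sCoeff η τ a (-z - twoL / 2 * η) := by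
    rw [← sCoeff_add_one (-(z + 1) - twoL / 2 * η)]; ring_nf
  rw [sNum, sNum, h1, h2, h3, h4]

lemma sNum_add_tau (hf : f ∈ thetaSpace twoL τ) (z : ℂ) :
    sNum twoL η τ a f (z + τ)
      = cexp (-((4 + 2 * twoL) * Real.pi * I * (2 * z + τ))) * sNum twoL η τ a f z := by
  have h1 := hf.2.2.2 (z + η)
  have h2 := hf.2.2.2 (z - η)
  have h3 := sCoeff_add_tau (η := η) (τ := τ) (a := a) (z - twoL / 2 * η)
  have h4 := sCoeff_add_tau (η := η) (τ := τ) (a := a) (-(z + τ) - twoL / 2 * η)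
  rw [show z + η + (τ : ℂ) = z + τ + η by ring] at h1
  rw [show z - η + (τ : ℂ) = z + τ - η by ring] at h2
  rw [show z - twoL / 2 * η + (τ : ℂ) = z + τ - twoL / 2 * η by ring] at h3
  rw [show -(z + (τ : ℂ)) - twoL / 2 * η + (τ : ℂ) = -z - twoL / 2 * η by ring] at h4
  have h5 : sCoeff η τ a (-(z + τ) - twoL / 2 * η)
      = cexp (4 * Real.pi * I * (τ + 2 * (-(z + τ) - twoL / 2 * η)))
        * sCoeff η τ a (-z - twoL / 2 * η) := by
    rw [h4, ← mul_assoc, ← Complex.exp_add, add_neg_cancel, Complex.exp_zero, one_mul]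
  have k1 : cexp (-(4 * Real.pi * I * (τ + 2 * (z - twoL / 2 * η))))
      * cexp (-(2 * twoL * Real.pi * I * (2 * (z + η) + τ)))
      = cexp (-((4 + 2 * twoL) * Real.pi * I * (2 * z + τ))) := by
    rw [← Complex.exp_add]; ring_nf
  have k2 : cexp (4 * Real.pi * I * (τ + 2 * (-(z + τ) - twoL / 2 * η)))
      * cexp (-(2 * twoL * Real.pi * I * (2 * (z - η) + τ)))
      = cexp (-((4 + 2 * twoL) * Real.pi * I * (2 * z + τ))) := by
    rw [← Complex.exp_add]; ring_nf
  rw [sNum, sNum, h1, h2, h3, h5]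
  linear_combination (sCoeff η τ a (z - twoL / 2 * η) * f (z + η)) * k1
    - (sCoeff η τ a (-z - twoL / 2 * η) * f (z - η)) * k2

lemma sNum_half_lattice (hf : f ∈ thetaSpace twoL τ) (m n : ℤ) :
    sNum twoL η τ a f ((m + n * τ) / 2) = 0 := by
  have hz : ∀ p : ℂ, sNum twoL η τ a f (-(p / 2) + p) = sNum twoL η τ a f (-(p / 2)) →
      sNum twoL η τ a f (p / 2) = 0 := by
    intro p hp
    rw [sNum_neg hf, show -(p / 2) + p = p / 2 by ring] at hp
    linear_combination hp / 2
  have h0 : ∀ i j : ℤ, (i = 0 ∨ i = 1) → (j = 0 ∨ j = 1) →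
      sNum twoL η τ a f ((i + j * τ) / 2) = 0 := by
    intro i j hi hj
    refine hz _ ?_
    rcases hj with rfl | rfl
    · rcases hi with rfl | rfl
      · simp
      · have := sNum_add_one (η := η) (a := a) hf (-((((1 : ℤ) : ℂ) + ((0 : ℤ) : ℂ) * τ) / 2))
        rw [← this]
        push_cast
        ring_nf
    · have h1 : ∀ z, sNum twoL η τ a f (z + i) = sNum twoL η τ a f z := by
        intro z
        rcases hi with rfl | rfl
        · simp
        · simpa using sNum_add_one hf z
      rw [show ∀ w : ℂ, w + ((i : ℂ) + ((1 : ℤ) : ℂ) * τ) = w + τ + i by intro w; push_cast; ring,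
        h1, sNum_add_tau hf]
      have he : cexp (-((4 + 2 * twoL) * Real.pi * I
          * (2 * -(((i : ℂ) + ((1 : ℤ) : ℂ) * τ) / 2) + τ))) = 1 := by
        rw [Complex.exp_eq_one_iff]
        exact ⟨(2 + twoL) * i, by push_cast; ring⟩
      rw [he, one_mul]
  have hq := quasiPeriod_lattice (f := sNum twoL η τ a f) (p := 1) (q := τ)
    ⟨fun _ ↦ 1, by fun_prop, by simp, fun z ↦ by rw [sNum_add_one hf, one_mul]⟩
    ⟨fun z ↦ cexp (-((4 + 2 * twoL) * Real.pi * I * (2 * z + τ))), by fun_prop,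
      fun z ↦ Complex.exp_ne_zero _, fun z ↦ sNum_add_tau hf z⟩ (m / 2) (n / 2)
  obtain ⟨u, -, -, hu⟩ := hq
  have h1 := hu ((((m % 2 : ℤ) : ℂ) + ((n % 2 : ℤ) : ℂ) * τ) / 2)
  rw [h0 _ _ (by omega) (by omega), mul_zero] at h1
  rw [← h1]
  congr 1
  have hm : (m : ℂ) = (m % 2 : ℤ) + 2 * (m / 2 : ℤ) := by
    exact_mod_cast (Int.emod_add_mul_ediv m 2).symm
  have hn : (n : ℂ) = (n % 2 : ℤ) + 2 * (n / 2 : ℤ) := by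
    exact_mod_cast (Int.emod_add_mul_ediv n 2).symm
  rw [hm, hn]
  ring_nf

lemma differentiable_br : Differentiable ℂ (br τ) := differentiable_theta 1 1 τ

lemma br_two_mul_cancel {F G : ℂ → ℂ} (hF : Differentiable ℂ F) (hG : Differentiable ℂ G)
    (h : ∀ z, br τ (2 * z) * F z = br τ (2 * z) * G z) : F = G := by
  have hb : Differentiable ℂ (br τ) := differentiable_br
  obtain ⟨z, hz⟩ := exists_theta_ne_zero τ
  refine entire_cancel (A := fun z ↦ br τ (2 * z)) (by fun_prop) hF hG ⟨z / 2, ?_⟩ h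
  rwa [mul_div_cancel₀ _ (two_ne_zero), br]

/-- The difference operators preserve `Θ₀₀^{4l+}`. -/
lemma exists_sklyaninGen (hf : f ∈ thetaSpace twoL τ) :
    ∃ g ∈ thetaSpace twoL τ, ∀ z, br τ (2 * z) * g z = sNum twoL η τ a f z := by
  have hd := differentiable_sNum (η := η) (a := a) hf
  obtain ⟨g, hg, hgz⟩ := theta_dvd τ (N := fun z ↦ sNum twoL η τ a f (z / 2)) (by fun_prop)
    (sNum_half_lattice hf)
  have key : ∀ z, br τ (2 * z) * g (2 * z) = sNum twoL η τ a f z := by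
    intro z
    rw [br, hgz, mul_div_cancel_left₀ _ two_ne_zero]
  refine ⟨fun z ↦ g (2 * z), ⟨by fun_prop, ?_, ?_, ?_⟩, key⟩
  · refine congrFun (br_two_mul_cancel (τ := τ) (F := fun z ↦ g (2 * (z + 1)))
      (by fun_prop) (by fun_prop) fun z ↦ ?_)
    have h := key (z + 1)
    rw [sNum_add_one hf, br, mul_add, mul_one, theta_add_two] at h
    rw [key z, br, mul_add, mul_one, h]
  · refine congrFun (br_two_mul_cancel (τ := τ) (F := fun z ↦ g (2 * -z))
      (by fun_prop) (by fun_prop) fun z ↦ ?_)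
    have h := key (-z)
    rw [sNum_neg hf, br, mul_neg, theta_one_one_neg] at h
    rw [key z, br, mul_neg]
    linear_combination -h
  · refine congrFun (br_two_mul_cancel (τ := τ) (F := fun z ↦ g (2 * (z + τ)))
      (by fun_prop) (by fun_prop) fun z ↦ ?_)
    have h := key (z + τ)
    rw [sNum_add_tau hf, br, mul_add, theta_add_two_tau, ← key z] at h
    have he : cexp (-((4 + 2 * twoL) * Real.pi * I * (2 * z + τ)))
        = cexp (-(4 * Real.pi * I * (τ + 2 * z)))
          * cexp (-(2 * twoL * Real.pi * I * (2 * z + τ))) := by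
      rw [← Complex.exp_add]; ring_nf
    rw [he] at h
    have h' : theta 1 1 (2 * z) τ * g (2 * z + 2 * τ)
        = cexp (-(2 * twoL * Real.pi * I * (2 * z + τ))) * (br τ (2 * z) * g (2 * z)) :=
      mul_left_cancel₀ (Complex.exp_ne_zero (-(4 * Real.pi * I * (τ + 2 * z))))
        (by linear_combination h)
    rw [mul_add, br, h', br]
    ring

end Generators

/-- The operator `ρ^l(S^a)` on `Θ₀₀^{4l+}`:
`(ρ^l(S^a) f)(z) = (s_a(z - lη) f(z + η) - s_a(-z - lη) f(z - η)) / θ₁₁(2z)`,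
an entire function of `z` (the singularities are removable). -/
def sklyaninGen (twoL : ℕ) (η : ℂ) (τ : ℍ) (a : Fin 4) :
    Module.End ℂ (thetaSpace twoL τ) where
  toFun f := ⟨(exists_sklyaninGen (η := η) (a := a) f.2).choose,
    (exists_sklyaninGen (η := η) (a := a) f.2).choose_spec.1⟩
  map_add' f g := by
    have h := fun f : thetaSpace twoL τ ↦ (exists_sklyaninGen (η := η) (a := a) f.2).choose_spec
    refine Subtype.ext (br_two_mul_cancel (τ := τ) (h (f + g)).1.1
      ((h f).1.1.add (h g).1.1) fun z ↦ ?_)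
    refine ((h (f + g)).2 z).trans ?_
    change _ = br τ (2 * z) * ((exists_sklyaninGen (η := η) (a := a) f.2).choose z
      + (exists_sklyaninGen (η := η) (a := a) g.2).choose z)
    rw [mul_add, (h f).2, (h g).2]
    simp only [sNum, Submodule.coe_add, Pi.add_apply]
    ring
  map_smul' c f := by
    have h := fun f : thetaSpace twoL τ ↦ (exists_sklyaninGen (η := η) (a := a) f.2).choose_spec
    refine Subtype.ext (br_two_mul_cancel (τ := τ) (h (c • f)).1.1
      ((h f).1.1.const_smul c) fun z ↦ ?_)
    refine ((h (c • f)).2 z).trans ?_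
    change _ = br τ (2 * z) * (c * (exists_sklyaninGen (η := η) (a := a) f.2).choose z)
    rw [mul_left_comm, (h f).2]
    simp only [sNum, Submodule.coe_smul, Pi.smul_apply, smul_eq_mul]
    ring

/-- The formula that characterises `ρ^l(S^a)`. -/
lemma sklyaninGen_apply (twoL : ℕ) (η : ℂ) (τ : ℍ) (a : Fin 4) (f : thetaSpace twoL τ) (z : ℂ) :
    theta 1 1 (2 * z) τ * (sklyaninGen twoL η τ a f : ℂ → ℂ) z
      = sCoeff η τ a (z - twoL / 2 * η) * (f : ℂ → ℂ) (z + η)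
        - sCoeff η τ a (-z - twoL / 2 * η) * (f : ℂ → ℂ) (z - η) :=
  (exists_sklyaninGen (η := η) (a := a) f.2).choose_spec.2 z

lemma brPair_mem (twoL : ℕ) (η : ℂ) (τ : ℍ) (a : ℂ) :
    brPair η τ twoL a ∈ thetaSpace twoL τ := by
  have hb : Differentiable ℂ (br τ) := differentiable_br
  refine ⟨?_, fun z ↦ ?_, fun z ↦ ?_, fun z ↦ ?_⟩
  · unfold brPair brProd
    fun_prop
  · simp only [brPair, brProd, ← Finset.prod_mul_distrib]
    refine Finset.prod_congr rfl fun j _ ↦ ?_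
    have h1 := theta_add_one 1 1 (z + a + 2 * j * η) τ
    have h2 := theta_add_one 1 1 (-(z + 1) + a + 2 * j * η) τ
    rw [show -(z + 1) + a + 2 * j * η + 1 = -z + a + 2 * j * η by ring] at h2
    rw [show z + a + 2 * j * η + 1 = z + 1 + a + 2 * j * η by ring] at h1
    rw [br, br, br, br, h1, h2]
    ring
  · rw [brPair, brPair, neg_neg, mul_comm]
  · simp only [brPair, brProd, ← Finset.prod_mul_distrib]
    have hc : cexp (-(2 * twoL * Real.pi * I * (2 * z + τ)))
        = ∏ _j ∈ Finset.range twoL, cexp (-(2 * Real.pi * I * (2 * z + τ))) := by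
      rw [Finset.prod_const, Finset.card_range, ← Complex.exp_nat_mul]
      ring_nf
    rw [hc, ← Finset.prod_mul_distrib]
    refine Finset.prod_congr rfl fun j _ ↦ ?_
    have h1 := theta_add_tau 1 1 (z + a + 2 * j * η) τ
    have h2 := theta_add_tau 1 1 (-(z + τ) + a + 2 * j * η) τ
    rw [show -(z + (τ : ℂ)) + a + 2 * j * η + τ = -z + a + 2 * j * η by ring] at h2
    rw [show z + a + 2 * j * η + (τ : ℂ) = z + τ + a + 2 * j * η by ring] at h1
    rw [br, br, br, br, h1, h2]
    have he : cexp (-(Real.pi * I * (τ + 2 * (z + a + 2 * j * η))))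
        = cexp (-(2 * Real.pi * I * (2 * z + τ)))
          * cexp (-(Real.pi * I * (τ + 2 * (-(z + τ) + a + 2 * j * η)))) := by
      rw [← Complex.exp_add]; ring_nf
    rw [he]
    ring

/-- The element `ω_λ(u; v) = [z; (λ + u - v)/2 + (-l + 1)η]_{2l}` of `Θ₀₀^{4l+}`. -/
def omega (twoL : ℕ) (η : ℂ) (τ : ℍ) (lam u v : ℂ) : thetaSpace twoL τ :=
  ⟨brPair η τ twoL ((lam + u - v) / 2 + (-(twoL / 2) + 1) * η), brPair_mem twoL η τ _⟩

/-! ### The transfer matrix -/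

open scoped TensorProduct

/-- The coefficients `W_a^L(u) = θ_a(u) / θ_a(η)` of the `L`-operator. -/
def wCoeff (η : ℂ) (τ : ℍ) (a : Fin 4) (u : ℂ) : ℂ := thetaIdx τ a u / thetaIdx τ a η

/-- The Pauli matrices `σ⁰, σ¹, σ², σ³`. -/
def pauli : Fin 4 → Matrix (Fin 2) (Fin 2) ℂ :=
  ![!![1, 0; 0, 1], !![0, 1; 1, 0], !![0, -I; I, 0], !![1, 0; 0, -1]]

/-- The `L`-operator `L(u) = ∑_a W_a^L(u) ρ^l(S^a) ⊗ σ^a`, as a `2 × 2` matrix of operators on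
`Θ₀₀^{4l+}`. -/
def lOp (twoL : ℕ) (η : ℂ) (τ : ℍ) (u : ℂ) :
    Matrix (Fin 2) (Fin 2) (Module.End ℂ (thetaSpace twoL τ)) :=
  Matrix.of fun i j ↦ ∑ a, (wCoeff η τ a u * pauli a i j) • sklyaninGen twoL η τ a

/-- The total space `V_N ⊗ ⋯ ⊗ V_1` with all `V_n = Θ₀₀^{4l+}`; the sites `1, …, N` are
numbered `0, …, N - 1` here. -/
abbrev StateSpace (N twoL : ℕ) (τ : ℍ) : Type := ⨂[ℂ] _ : Fin N, thetaSpace twoL τ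

/-- The space `(ℂ^{2l+1})^{⊗ N}`. -/
abbrev SourceSpace (N twoL : ℕ) : Type := ⨂[ℂ] _ : Fin N, (Fin (twoL + 1) → ℂ)

/-- The operator `1 ⊗ ⋯ ⊗ X ⊗ ⋯ ⊗ 1` with `X` at the site `n`. -/
def atSite {N twoL : ℕ} {τ : ℍ} (n : Fin N) (X : Module.End ℂ (thetaSpace twoL τ)) :
    Module.End ℂ (StateSpace N twoL τ) :=
  PiTensorProduct.map (Function.update (fun _ ↦ LinearMap.id) n X)

/-- The local `L`-operator `L_n(u) = ∑_a W_a^L(u) ρ_n(S^a) ⊗ σ^a`. -/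
def lSite (N twoL : ℕ) (η : ℂ) (τ : ℍ) (n : Fin N) (u : ℂ) :
    Matrix (Fin 2) (Fin 2) (Module.End ℂ (StateSpace N twoL τ)) :=
  Matrix.of fun i j ↦ ∑ a, (wCoeff η τ a u * pauli a i j) • atSite n (sklyaninGen twoL η τ a)

/-- The transfer matrix `T(u) = tr₀ L_N(u) ⋯ L_1(u)`. -/
def transferMatrix (N twoL : ℕ) (η : ℂ) (τ : ℍ) (u : ℂ) : Module.End ℂ (StateSpace N twoL τ) :=
  (List.ofFn fun n ↦ lSite N twoL η τ n u).reverse.prod.trace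

/-! ### The gauge matrices and the matrix `S(u)` -/

/-- The gauge transformation matrix `M_λ(v)`. -/
def gaugeMatrix (τ : ℍ) (lam v : ℂ) : Matrix (Fin 2) (Fin 2) ℂ :=
  !![-theta 0 0 ((lam - v) / 2) (τ / 2), -theta 0 0 ((lam + v) / 2) (τ / 2);
     theta 0 1 ((lam - v) / 2) (τ / 2), theta 0 1 ((lam + v) / 2) (τ / 2)]

/-- The parameter `λ₀ + 4 i'' l η`. The index `i'' = 1, …, 2r` is `i + 1` with `i : Fin (2r)`. -/
def lamAt (twoL : ℕ) (η lam₀ : ℂ) {r : ℕ} (i : Fin (2 * r)) : ℂ :=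
  lam₀ + 4 * ((i : ℕ) + 1) * (twoL / 2) * η

open scoped Kronecker in
/-- `M = ∑_{i''} M̃_{i''} ⊗ E^{i''}_{i''}` with `M̃_{i''} = M_{λ₀ + 4 i'' l η}(v)`. -/
def gaugeBlock (twoL r : ℕ) (η : ℂ) (τ : ℍ) (lam₀ v : ℂ) :
    Matrix (Fin 2 × Fin (2 * r)) (Fin 2 × Fin (2 * r)) ℂ :=
  ∑ i, gaugeMatrix τ (lamAt twoL η lam₀ i) v ⊗ₖ Matrix.single i i 1

/-- The linear map `ℂ^{2l+1} → Θ₀₀^{4l+}` with `e_k ↦ w_k`. -/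
def ofBasis {twoL : ℕ} {τ : ℍ} (w : Fin (twoL + 1) → thetaSpace twoL τ) :
    (Fin (twoL + 1) → ℂ) →ₗ[ℂ] thetaSpace twoL τ :=
  Fintype.linearCombination ℂ w

/-- The cyclically tridiagonal matrix `S(u)`:
`S^{j''±1}_{j''}(u) : e_k ↦ c_{k j''} ω_{±λ₀ ± 4 j'' l η}(u; ±v)`, indices modulo `2r`,
and all other entries vanish. -/
def sMatrix (twoL r : ℕ) (η : ℂ) (τ : ℍ) (lam₀ v : ℂ)
    (c : Fin (twoL + 1) → Fin (2 * r) → ℂ) (u : ℂ) :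
    Matrix (Fin (2 * r)) (Fin (2 * r)) ((Fin (twoL + 1) → ℂ) →ₗ[ℂ] thetaSpace twoL τ) :=
  Matrix.of fun i j ↦
    if (i : ℕ) ≡ (j : ℕ) + 1 [MOD 2 * r] then
      ofBasis fun k ↦ c k j • omega twoL η τ (lamAt twoL η lam₀ j) u v
    else if (i : ℕ) + 1 ≡ (j : ℕ) [MOD 2 * r] then
      ofBasis fun k ↦ c k j • omega twoL η τ (-lamAt twoL η lam₀ j) u (-v)
    else 0

/-- `L ⊗ S`, the matrix with the entries `L^{i'}_{j'} S^{i''}_{j''}`. -/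
def tensorMat {I U V : Type*} [AddCommGroup U] [Module ℂ U] [AddCommGroup V] [Module ℂ V]
    (L : Matrix (Fin 2) (Fin 2) (Module.End ℂ V)) (S : Matrix I I (U →ₗ[ℂ] V)) :
    Matrix (Fin 2 × I) (Fin 2 × I) (U →ₗ[ℂ] V) :=
  Matrix.of fun p q ↦ L p.1 q.1 ∘ₗ S p.2 q.2

/-- The product `A B C` of matrices, where `A` and `C` have scalar entries and `B` has entries in
a vector space. -/
def sandwich {I W : Type*} [Fintype I] [AddCommGroup W] [Module ℂ W]
    (A : Matrix I I ℂ) (B : Matrix I I W) (C : Matrix I I ℂ) : Matrix I I W :=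
  Matrix.of fun i j ↦ ∑ k, ∑ m, (A i k * C m j) • B k m

/-- The two copies of the second index, according to the first index. -/
def blockIndex {I : Type*} : I ⊕ I → Fin 2 × I := Sum.elim (Prod.mk 0) (Prod.mk 1)

/-- The diagonal matrix `X = diag([λ₀ + 4 i'' l η])`. -/
def xMatrix (twoL r : ℕ) (η : ℂ) (τ : ℍ) (lam₀ : ℂ) : Matrix (Fin (2 * r)) (Fin (2 * r)) ℂ :=
  Matrix.diagonal fun i ↦ br τ (lamAt twoL η lam₀ i)

/-- `tr S_N S_{N-1} ⋯ S_1`, where `S_n` is the matrix `S` of linear maps acting at the site `n`: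
the sum over all `i''_1, …, i''_N` of
`S^{i''_N}_{i''_{N-1}} ⊗ ⋯ ⊗ S^{i''_2}_{i''_1} ⊗ S^{i''_1}_{i''_N}`. -/
def siteTrace (N : ℕ) {I U V : Type*} [Fintype I] [AddCommGroup U] [Module ℂ U]
    [AddCommGroup V] [Module ℂ V] (S : Matrix I I (U →ₗ[ℂ] V)) :
    (⨂[ℂ] _ : Fin N, U) →ₗ[ℂ] ⨂[ℂ] _ : Fin N, V :=
  ∑ i : Fin N → I, PiTensorProduct.map fun n ↦ S (i n) (i ((finRotate N).symm n))

/-- The operator `Q_R(u) = tr S_N(u) ⋯ S_1(u)`. -/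
def qR (N twoL r : ℕ) (η : ℂ) (τ : ℍ) (lam₀ v : ℂ)
    (c : Fin (twoL + 1) → Fin (2 * r) → ℂ) (u : ℂ) :
    SourceSpace N twoL →ₗ[ℂ] StateSpace N twoL τ :=
  siteTrace N (sMatrix twoL r η τ lam₀ v c u)

/-- `h_+(u) = (2 [u - 2lη])^N`. -/
def hPlus (N twoL : ℕ) (η : ℂ) (τ : ℍ) (u : ℂ) : ℂ := (2 * br τ (u - twoL * η)) ^ N

/-- `h_-(u) = (2 [u + 2lη])^N`. -/
def hMinus (N twoL : ℕ) (η : ℂ) (τ : ℍ) (u : ℂ) : ℂ := (2 * br τ (u + twoL * η)) ^ N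

end Sklyanin
end

open Sklyanin

noncomputable section

namespace Sklyanin

open Complex Filter Topology

open UpperHalfPlane hiding I

open scoped TensorProduct

/-! Locally, the coefficients of `f (z + η)` and `f (z - η)` in `L(u) f` are 2×2 matrices of rank
one, a column times a row of theta functions of modulus τ/2 (`sum_thetaIdx_mul`, `lOp_apply`). The
columns of M_λ(v) are such columns up to sign, and the rows of its inverse are such rows up to a
scalar. A row paired with a column is a product of two brackets (`rowVec_dot_colVec`). Hence each
entry of M_λ'(v)⁻¹ L(u) M_λ(v), applied to ω_λ(u; v) with λ' = λ + 4lη, is a difference of two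
explicit products.

Up to a ratio of two brackets, the value of ω_λ(u; v) at z + η is the value of ω_λ(u ∓ 2η; v) at z
(`omega_shift_sub`, `omega_shift_add`), and evenness handles z - η. In the lower left entry the two
products then coincide and cancel. In the diagonal entries the three-term identity of [z] combines
them and produces the factor [2z] that cancels the denominator (`gauged_zero_zero`,
`gauged_one_zero`, `gauged_one_one`).

The matrix S(u) joins only neighbouring parameters λ₀ + 4i''lη. Steps in one direction are the local
statement; those in the other reduce to it by M_{-λ}(-v) = M_λ(v). A full turn of 2r steps changes λ
by 4r', and the period 2 of M and [·] closes the cycle. This gives `sandwich_gaugeBlock_eq`.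

Globally, T(u) and Q_R(u) are both traces over the sites, and their composition is the trace of L ⊗
S (`transferMatrix_eq`, `siteTrace_comp`). Such a trace is invariant under conjugation, is additive
over the diagonal blocks of a triangular matrix, and turns a scalar into its N-th power, which
yields h_∓. -/

/-! ### Half-integer shifts and the product formula for theta functions -/

/-- The general term of the series of `θ_{ab}`. -/
def thetaTerm (a b : ℕ) (z τ : ℂ) (n : ℤ) : ℂ :=
  cexp (Real.pi * I * ((a : ℂ) / 2 + n) ^ 2 * τ
    + 2 * Real.pi * I * ((a : ℂ) / 2 + n) * ((b : ℂ) / 2 + z))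

lemma summable_thetaTerm (a b : ℕ) (z : ℂ) {τ : ℂ} (hτ : 0 < τ.im) :
    Summable fun n ↦ ‖thetaTerm a b z τ n‖ := by
  have h := (((summable_jacobiTheta₂_term_iff (z + (b : ℂ) / 2 + (a : ℂ) * τ / 2) τ).2
    hτ).mul_left (cexp (Real.pi * I * ((a : ℂ) / 2) ^ 2 * τ
      + 2 * Real.pi * I * ((a : ℂ) / 2) * ((b : ℂ) / 2 + z)))).norm
  refine h.congr fun n ↦ ?_
  rw [thetaTerm, jacobiTheta₂_term, ← Complex.exp_add]
  ring_nf

/-- Only b/2 + z enters the series. Every identity with b = 1 can thus be obtained from b = 0 by a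
half shift. -/
lemma theta_char_one (a : ℕ) (z τ : ℂ) : theta a 1 z τ = theta a 0 (z + 1 / 2) τ := by
  unfold theta
  refine tsum_congr fun n ↦ ?_
  push_cast
  ring_nf

lemma theta_zero_zero_neg (z τ : ℂ) : theta 0 0 (-z) τ = theta 0 0 z τ := by
  rw [theta_eq, theta_eq, ← jacobiTheta₂_neg_left]
  simp

lemma theta_zero_one_neg (z τ : ℂ) : theta 0 1 (-z) τ = theta 0 1 z τ := by
  rw [theta_char_one, theta_char_one, ← theta_zero_zero_neg]
  have := theta_add_one 0 0 (-(-z + 1 / 2)) τ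
  rw [pow_zero, one_mul] at this
  rw [← this]
  ring_nf

/-- Pairs of integers are of the form `(p + q, p - q)` or `(p + q + 1, p - q)`, according to the
parity of their sum. -/
def parityEquiv : (ℤ × ℤ) ⊕ (ℤ × ℤ) ≃ ℤ × ℤ where
  toFun := Sum.elim (fun x ↦ (x.1 + x.2, x.1 - x.2)) (fun x ↦ (x.1 + x.2 + 1, x.1 - x.2))
  -- When the sum is odd, so is the difference, and integer division rounds both halves down to the
  -- p and q of the second form.
  invFun y := if (y.1 + y.2) % 2 = 0 then .inl ((y.1 + y.2) / 2, (y.1 - y.2) / 2)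
    else .inr ((y.1 + y.2) / 2, (y.1 - y.2) / 2)
  left_inv := by
    rintro (⟨p, q⟩ | ⟨p, q⟩)
    · have h : (p + q + (p - q)) % 2 = 0 := by omega
      simp only [Sum.elim_inl, h, if_true, Sum.inl.injEq, Prod.mk.injEq]
      omega
    · have h : ¬ (p + q + 1 + (p - q)) % 2 = 0 := by omega
      simp only [Sum.elim_inr, h, if_false, Sum.inr.injEq, Prod.mk.injEq]
      omega
  right_inv := by
    rintro ⟨m, n⟩
    by_cases h : (m + n) % 2 = 0
    · simp only [h, if_true, Sum.elim_inl, Prod.mk.injEq]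
      omega
    · simp only [h, if_false, Sum.elim_inr, Prod.mk.injEq]
      omega

/-- The product formula relating theta functions of moduli `τ / 2` and `τ`. -/
lemma theta_half_mul (x y : ℂ) (τ : ℍ) :
    theta 0 0 x (τ / 2) * theta 0 0 y (τ / 2)
      = theta 0 0 (x + y) τ * theta 0 0 (x - y) τ
        + theta 1 0 (x + y) τ * theta 1 0 (x - y) τ := by
  have hτ : 0 < (τ : ℂ).im := τ.im_pos
  have hτ2 : 0 < ((τ : ℂ) / 2).im := by simpa using hτ
  have hS := summable_mul_of_summable_norm (summable_thetaTerm 0 0 x hτ2)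
    (summable_thetaTerm 0 0 y hτ2)
  have hprod : ∀ a, theta a 0 (x + y) τ * theta a 0 (x - y) τ
      = ∑' p : ℤ × ℤ, thetaTerm a 0 (x + y) τ p.1 * thetaTerm a 0 (x - y) τ p.2 := fun a ↦
    tsum_mul_tsum_of_summable_norm (summable_thetaTerm a 0 _ hτ) (summable_thetaTerm a 0 _ hτ)
  have hprod2 : theta 0 0 x (τ / 2) * theta 0 0 y (τ / 2)
      = ∑' p : ℤ × ℤ, thetaTerm 0 0 x (τ / 2) p.1 * thetaTerm 0 0 y (τ / 2) p.2 :=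
    tsum_mul_tsum_of_summable_norm (summable_thetaTerm 0 0 _ hτ2) (summable_thetaTerm 0 0 _ hτ2)
  have hS' := (parityEquiv.summable_iff).2 hS
  -- With m = p + q, n = p - q one has m² + n² = 2(p² + q²) and mx + ny = p(x + y) + q(x - y). In
  -- the other parity class p and q are replaced by p + 1/2 and q + 1/2, which gives the
  -- characteristic a = 1.
  rw [hprod2, hprod, hprod, ← parityEquiv.tsum_eq, Summable.tsum_sum]
  · congr 1 <;>
    · refine tsum_congr fun p ↦ ?_
      simp only [parityEquiv, Equiv.coe_fn_mk, Sum.elim_inl, Sum.elim_inr, thetaTerm,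
        ← Complex.exp_add]
      push_cast
      ring_nf
  · exact hS'.comp_injective Sum.inl_injective
  · exact hS'.comp_injective Sum.inr_injective

/-- Moving x by 1/2 in `theta_half_mul` moves both x + y and x - y by 1/2, so all factors acquire b
= 1. -/
lemma theta_half_mul_one_zero (x y : ℂ) (τ : ℍ) :
    theta 0 1 x (τ / 2) * theta 0 0 y (τ / 2)
      = theta 0 1 (x + y) τ * theta 0 1 (x - y) τ + br τ (x + y) * br τ (x - y) := by
  rw [br, br, theta_char_one, theta_half_mul, theta_char_one, theta_char_one, theta_char_one,
    theta_char_one]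
  ring_nf

lemma theta_half_mul_zero_one (x y : ℂ) (τ : ℍ) :
    theta 0 0 x (τ / 2) * theta 0 1 y (τ / 2)
      = theta 0 1 (x + y) τ * theta 0 1 (x - y) τ - br τ (x + y) * br τ (x - y) := by
  rw [mul_comm, theta_half_mul_one_zero, ← neg_sub x y, theta_zero_one_neg, add_comm y]
  simp only [br]
  rw [theta_one_one_neg]
  ring

/-- Moving both x and y by 1/2 fixes x - y and moves x + y by 1, under which θ₁₀ changes sign and
θ₀₀ does not. -/
lemma theta_half_mul_one_one (x y : ℂ) (τ : ℍ) :
    theta 0 1 x (τ / 2) * theta 0 1 y (τ / 2)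
      = theta 0 0 (x + y) τ * theta 0 0 (x - y) τ
        - theta 1 0 (x + y) τ * theta 1 0 (x - y) τ := by
  have h0 := theta_add_one 0 0 (x + y) τ
  have h1 := theta_add_one 1 0 (x + y) τ
  rw [theta_char_one, theta_char_one, theta_half_mul,
    show x + 1 / 2 + (y + 1 / 2) = x + y + 1 by ring, h0, h1]
  ring_nf

lemma br_neg (τ : ℍ) (z : ℂ) : br τ (-z) = -br τ z := theta_one_one_neg z τ

/-- A product of brackets is a 2×2 determinant of theta functions of modulus τ/2. Both the
three-term identity and the row-column pairings rest on this. -/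
lemma br_mul_br (x y : ℂ) (τ : ℍ) :
    theta 0 1 x (τ / 2) * theta 0 0 y (τ / 2) - theta 0 0 x (τ / 2) * theta 0 1 y (τ / 2)
      = 2 * (br τ (x + y) * br τ (x - y)) := by
  rw [theta_half_mul_one_zero, theta_half_mul_zero_one]
  ring

/-- The three-term identity of `[z]`. -/
lemma br_three_term (τ : ℍ) (x y z w : ℂ) :
    br τ (x + y) * br τ (x - y) * (br τ (z + w) * br τ (z - w))
      - br τ (x + z) * br τ (x - z) * (br τ (y + w) * br τ (y - w))
      + br τ (x + w) * br τ (x - w) * (br τ (y + z) * br τ (y - z)) = 0 := by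
  -- With each product of brackets written as a minor, the identity is the Plücker relation for a
  -- 2×4 matrix.
  have h : ∀ p q, br τ (p + q) * br τ (p - q)
      = (theta 0 1 p (τ / 2) * theta 0 0 q (τ / 2)
        - theta 0 0 p (τ / 2) * theta 0 1 q (τ / 2)) / 2 := fun p q ↦ by
    rw [br_mul_br]; ring
  simp only [h]
  ring

/-- The three-term identity at A + v/2, B - v/2, z + v/2, z - v/2. The left side is antisymmetric in
z, as are the numerators of the difference operators, and the right side exhibits the factor [2z] to
be divided out. -/
lemma br_addition (τ : ℍ) (A B v z : ℂ) :
    br τ (A + z) * br τ (A + v - z) * br τ (B + z) * br τ (v - B + z)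
      - br τ (A - z) * br τ (A + v + z) * br τ (B - z) * br τ (v - B - z)
      = br τ (A - B + v) * br τ v * br τ (2 * z) * br τ (A + B) := by
  have h := br_three_term τ (A + v / 2) (B - v / 2) (z + v / 2) (z - v / 2)
  rw [show A + v / 2 + (B - v / 2) = A + B by ring,
    show A + v / 2 - (B - v / 2) = A - B + v by ring,
    show z + v / 2 + (z - v / 2) = 2 * z by ring, show z + v / 2 - (z - v / 2) = v by ring,
    show A + v / 2 + (z + v / 2) = A + v + z by ring,
    show A + v / 2 - (z + v / 2) = A - z by ring,
    show B - v / 2 + (z - v / 2) = -(v - B - z) by ring,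
    show B - v / 2 - (z - v / 2) = B - z by ring,
    show A + v / 2 + (z - v / 2) = A + z by ring,
    show A + v / 2 - (z - v / 2) = A + v - z by ring,
    show B - v / 2 + (z + v / 2) = B + z by ring,
    show B - v / 2 - (z + v / 2) = -(v - B + z) by ring, br_neg, br_neg] at h
  linear_combination -h

/-! ### Non-vanishing of the theta constants at a small real `η` -/

lemma br_ne_zero {τ : ℍ} {z : ℂ} (h : ∀ m n : ℤ, z ≠ m + n * τ) : br τ z ≠ 0 := by
  obtain ⟨c, hc, hcz⟩ := theta_eq_thetaProd τ
  rw [br, hcz]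
  refine mul_ne_zero hc fun h0 ↦ ?_
  obtain ⟨m, n, hmn⟩ := thetaProd_eq_zero h0
  exact h m n hmn

/-- θ_{0b}(z) and θ_{1b}(z - τ/2) are the same `jacobiTheta₂` value up to exponential factors. -/
lemma theta_zero_ne_zero {b : ℕ} {z τ : ℂ} (h : theta 1 b (z - τ / 2) τ ≠ 0) :
    theta 0 b z τ ≠ 0 := by
  intro h0
  apply h
  rw [theta_eq] at h0 ⊢
  have h1 := (mul_eq_zero.1 h0).resolve_left (Complex.exp_ne_zero _)
  rw [mul_eq_zero]
  right
  rw [← h1]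
  push_cast
  ring_nf

/-- The other three thetas are, up to exponential factors, θ₁₁ at η - 1/2, η - τ/2 - 1/2 and η -
τ/2. For real η with 0 < |η| < 1/2 neither η nor these points lie in ℤ + ℤτ. This makes the
denominators θ_a(η) in `wCoeff` legitimate. -/
lemma thetaIdx_ne_zero (τ : ℍ) {η : ℝ} (h0 : η ≠ 0) (h1 : |η| < 1 / 2) (a : Fin 4) :
    thetaIdx τ a η ≠ 0 := by
  have hτ := τ.im_pos
  have hη := abs_lt.1 h1
  have himn : ∀ {n : ℤ}, (n : ℝ) * τ.im = 0 → n = 0 := fun {n} h ↦ by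
    simpa [hτ.ne'] using h
  have hn2 : ∀ {n : ℤ}, (n : ℝ) * τ.im ≠ -(τ.im / 2) := fun {n} h ↦ by
    have h' : ((2 * n + 1 : ℤ) : ℝ) = 0 := by
      push_cast
      apply mul_right_cancel₀ hτ.ne'
      linarith
    have := Int.cast_eq_zero.1 h'
    omega
  have h10 : ∀ m n : ℤ, (η : ℂ) - 1 / 2 ≠ m + n * τ := fun m n h ↦ by
    have hi := congrArg Complex.im h
    have hr := congrArg Complex.re h
    simp at hi hr
    have hn : n = 0 := by
      rcases hi with h | h
      · exact h
      · exact absurd h hτ.ne'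
    subst hn
    simp at hr
    have h3 : (-1 : ℝ) < m := by linarith
    have h4 : (m : ℝ) < 0 := by linarith
    have h5 : -1 < m := by exact_mod_cast h3
    have h6 : m < 0 := by exact_mod_cast h4
    omega
  -- A lattice point has imaginary part an integer multiple of Im τ, never minus one half of it.
  have key : ∀ w : ℂ, w.im = -(τ.im / 2) → ∀ m n : ℤ, w ≠ m + n * τ := fun w hw m n h ↦ by
    have hi := congrArg Complex.im h
    rw [hw] at hi
    simp at hi
    exact hn2 hi.symm
  fin_cases a
  · refine br_ne_zero fun m n h ↦ ?_
    have hi := congrArg Complex.im h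
    have hr := congrArg Complex.re h
    simp at hi hr
    have hn : n = 0 := by
      rcases hi with h | h
      · exact h
      · exact absurd h hτ.ne'
    subst hn
    simp at hr
    have h3 : (-1 : ℝ) < m := by linarith
    have h4 : (m : ℝ) < 1 := by linarith
    have h5 : -1 < m := by exact_mod_cast h3
    have h6 : m < 1 := by exact_mod_cast h4
    have h7 : m = 0 := by omega
    exact h0 (by rw [hr, h7]; simp)
  · have h := br_ne_zero h10
    rwa [br, theta_char_one, sub_add_cancel] at h
  · refine theta_zero_ne_zero (b := 0) ?_
    have h := br_ne_zero (key ((η : ℂ) - τ / 2 - 1 / 2) (by simp))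
    rwa [br, theta_char_one, sub_add_cancel] at h
  · refine theta_zero_ne_zero (b := 1) ?_
    exact br_ne_zero (key ((η : ℂ) - τ / 2) (by simp))

/-! ### Factorization of the `L`-operator and the gauge transformation -/

/-- The column vector in the factorization of the `L`-operator. -/
def colVec (τ : ℍ) (x : ℂ) : Fin 2 → ℂ := ![theta 0 0 x (τ / 2), -theta 0 1 x (τ / 2)]

/-- The row vector in the factorization of the `L`-operator. -/
def rowVec (τ : ℍ) (x : ℂ) : Fin 2 → ℂ := ![theta 0 1 x (τ / 2), theta 0 0 x (τ / 2)]

/-- The pairing is the determinant of the two underlying theta vectors, hence a product of brackets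
by `br_mul_br`. -/
lemma rowVec_dot_colVec (τ : ℍ) (x y : ℂ) :
    ∑ i, rowVec τ x i * colVec τ y i = 2 * (br τ (x + y) * br τ (x - y)) := by
  rw [← br_mul_br, Fin.sum_univ_two]
  simp only [rowVec, colVec, Matrix.cons_val_zero, Matrix.cons_val_one]
  ring

lemma colVec_neg (τ : ℍ) (x : ℂ) : colVec τ (-x) = colVec τ x := by
  rw [colVec, colVec, theta_zero_zero_neg, theta_zero_one_neg]

lemma colVec_add_one (τ : ℍ) (x : ℂ) : colVec τ (x + 1) = colVec τ x := by
  rw [colVec, colVec, theta_add_one, theta_add_one]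
  simp

/-- The coefficients of the shift operators in `L(u)` form a matrix of rank one. -/
lemma sum_thetaIdx_mul (τ : ℍ) (u x : ℂ) (i j : Fin 2) :
    ∑ a, (if a = 2 then I else 1) * pauli a i j * thetaIdx τ a u * thetaIdx τ a x
      = colVec τ ((u - x) / 2) i * rowVec τ ((u + x) / 2) j := by
  have e1 : (u + x) / 2 + (u - x) / 2 = u := by ring
  have e2 : (u + x) / 2 - (u - x) / 2 = x := by ring
  have h00 := theta_half_mul ((u + x) / 2) ((u - x) / 2) τ
  have h01 := theta_half_mul_zero_one ((u + x) / 2) ((u - x) / 2) τ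
  have h10 := theta_half_mul_one_zero ((u + x) / 2) ((u - x) / 2) τ
  have h11 := theta_half_mul_one_one ((u + x) / 2) ((u - x) / 2) τ
  rw [e1, e2] at h00 h01 h10 h11
  rw [br, br] at h01 h10
  fin_cases i <;> fin_cases j <;>
    simp [Fin.sum_univ_four, pauli, thetaIdx, colVec, rowVec]
  · linear_combination -h10
  · linear_combination -h00
  · linear_combination h11
  · linear_combination h01

section Parameters

variable {twoL : ℕ} {η : ℂ} {τ : ℍ}

/-- The action of the entries of `L(u)` as difference operators. -/
lemma lOp_apply (hη : ∀ a, thetaIdx τ a η ≠ 0) (u : ℂ) (i j : Fin 2) (f : thetaSpace twoL τ)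
    (z : ℂ) :
    br τ (2 * z) * (lOp twoL η τ u i j f : ℂ → ℂ) z
      = colVec τ (u / 2 - z + twoL / 2 * η) i * rowVec τ (u / 2 + z - twoL / 2 * η) j
          * (f : ℂ → ℂ) (z + η)
        - colVec τ (u / 2 + z + twoL / 2 * η) i * rowVec τ (u / 2 - z - twoL / 2 * η) j
          * (f : ℂ → ℂ) (z - η) := by
  have h := fun x : ℂ ↦ sum_thetaIdx_mul τ u (2 * (x - twoL / 2 * η)) i j
  have hx := fun x : ℂ ↦ show (u - 2 * (x - twoL / 2 * η)) / 2 = u / 2 - x + twoL / 2 * η by ring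
  have hy := fun x : ℂ ↦ show (u + 2 * (x - twoL / 2 * η)) / 2 = u / 2 + x - twoL / 2 * η by ring
  have h1 := h z
  have h2 := h (-z)
  rw [hx, hy] at h1 h2
  rw [sub_neg_eq_add, ← sub_eq_add_neg] at h2
  rw [← h1, ← h2, lOp, Matrix.of_apply, LinearMap.sum_apply, Submodule.coe_sum, Finset.sum_apply,
    Finset.mul_sum, Finset.sum_mul, Finset.sum_mul, ← Finset.sum_sub_distrib]
  refine Finset.sum_congr rfl fun a _ ↦ ?_
  rw [LinearMap.smul_apply, Submodule.coe_smul, Pi.smul_apply, smul_eq_mul, mul_left_comm, br,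
    sklyaninGen_apply, wCoeff, sCoeff, sCoeff]
  -- The factor θ_a(η) of `sCoeff` cancels the denominator of `wCoeff`, leaving the rank-one sum.
  field_simp [hη a]

lemma gaugeMatrix_apply_zero (lam v : ℂ) (i : Fin 2) :
    gaugeMatrix τ lam v i 0 = -colVec τ ((lam - v) / 2) i := by
  fin_cases i <;> simp [gaugeMatrix, colVec]

lemma gaugeMatrix_apply_one (lam v : ℂ) (i : Fin 2) :
    gaugeMatrix τ lam v i 1 = -colVec τ ((lam + v) / 2) i := by
  fin_cases i <;> simp [gaugeMatrix, colVec]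

lemma det_gaugeMatrix (lam v : ℂ) :
    (gaugeMatrix τ lam v).det = -(2 * (br τ lam * br τ v)) := by
  have h := br_mul_br ((lam + v) / 2) ((lam - v) / 2) τ
  rw [show (lam + v) / 2 + (lam - v) / 2 = lam by ring,
    show (lam + v) / 2 - (lam - v) / 2 = v by ring] at h
  rw [← h, gaugeMatrix, Matrix.det_fin_two_of]
  ring

/-- The adjugate turns the columns of M_λ(v) into row vectors, so M_λ(v)⁻¹ applied to a column is
again governed by `rowVec_dot_colVec`. -/
lemma gaugeMatrix_inv_zero (lam v : ℂ) (i : Fin 2) :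
    (gaugeMatrix τ lam v)⁻¹ 0 i
      = (-(2 * (br τ lam * br τ v)))⁻¹ * rowVec τ ((lam + v) / 2) i := by
  rw [Matrix.inv_def, det_gaugeMatrix, Matrix.adjugate_fin_two, Ring.inverse_eq_inv']
  fin_cases i <;> simp [gaugeMatrix, rowVec]

lemma gaugeMatrix_inv_one (lam v : ℂ) (i : Fin 2) :
    (gaugeMatrix τ lam v)⁻¹ 1 i
      = (2 * (br τ lam * br τ v))⁻¹ * rowVec τ ((lam - v) / 2) i := by
  rw [Matrix.inv_def, det_gaugeMatrix, Matrix.adjugate_fin_two, Ring.inverse_eq_inv']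
  fin_cases i <;> simp [gaugeMatrix, rowVec]

lemma isUnit_det_gaugeMatrix {lam v : ℂ} (h : br τ lam ≠ 0) (hv : br τ v ≠ 0) :
    IsUnit (gaugeMatrix τ lam v).det := by
  rw [det_gaugeMatrix, isUnit_iff_ne_zero]
  exact neg_ne_zero.2 (mul_ne_zero two_ne_zero (mul_ne_zero h hv))

/-- By evenness of the column vectors. It lets the entries of S(u) that lower the index be treated
as index-raising ones with (-λ, -v). -/
lemma gaugeMatrix_neg (lam v : ℂ) : gaugeMatrix τ (-lam) (-v) = gaugeMatrix τ lam v := by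
  ext i j
  fin_cases j
  · simp only [Fin.zero_eta, gaugeMatrix_apply_zero]
    rw [← colVec_neg]
    ring_nf
  · simp only [Fin.mk_one, gaugeMatrix_apply_one]
    rw [← colVec_neg]
    ring_nf

/-- Moving λ by 2 moves the arguments of the columns by 1. This is what allows the indices to be
read modulo 2r. -/
lemma gaugeMatrix_periodic (v : ℂ) : Function.Periodic (fun lam ↦ gaugeMatrix τ lam v) 2 := by
  intro lam
  ext i j
  fin_cases j
  · simp only [Fin.zero_eta, gaugeMatrix_apply_zero]
    rw [← colVec_add_one τ ((lam - v) / 2)]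
    ring_nf
  · simp only [Fin.mk_one, gaugeMatrix_apply_one]
    rw [← colVec_add_one τ ((lam + v) / 2)]
    ring_nf

lemma br_periodic : Function.Periodic (br τ) 2 := fun z ↦ theta_add_two 1 1 z τ

/-! ### Shifts of the local vectors `ω_λ(u; v)` -/

/-- Both sides are [z]_{k+1}, with the first or the last factor split off. -/
lemma br_mul_brProd (k : ℕ) (z : ℂ) :
    br τ z * brProd η τ k (z + 2 * η) = br τ (z + 2 * k * η) * brProd η τ k z := by
  have h1 := Finset.prod_range_succ (fun j : ℕ ↦ br τ (z + 2 * j * η)) k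
  have h2 := Finset.prod_range_succ' (fun j : ℕ ↦ br τ (z + 2 * j * η)) k
  rw [h1] at h2
  have h3 : brProd η τ k (z + 2 * η)
      = ∏ j ∈ Finset.range k, br τ (z + 2 * ((j + 1 : ℕ) : ℂ) * η) :=
    Finset.prod_congr rfl fun j _ ↦ by congr 1; push_cast; ring
  rw [h3, brProd, mul_comm, mul_comm (br τ (z + 2 * k * η)), h2]
  congr 2
  push_cast
  ring

/-- Passing from (z + η, u) to (z, u - 2η) leaves -z + a unchanged and lowers z + a by 2η. One half
of `brPair` is therefore common, and the other telescopes by `br_mul_brProd`. -/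
lemma omega_shift_sub (lam u v z : ℂ) :
    br τ (z + (lam + u - v) / 2 - twoL / 2 * η) * (omega twoL η τ lam u v : ℂ → ℂ) (z + η)
      = br τ (z + (lam + u - v) / 2 + 3 * (twoL / 2) * η)
        * (omega twoL η τ lam (u - 2 * η) v : ℂ → ℂ) z := by
  have h := br_mul_brProd (η := η) (τ := τ) twoL (z + (lam + u - v) / 2 - twoL / 2 * η)
  simp only [omega, brPair]
  rw [show z + η + ((lam + u - v) / 2 + (-(twoL / 2) + 1) * η)
      = z + (lam + u - v) / 2 - twoL / 2 * η + 2 * η by ring, ← mul_assoc, h]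
  ring_nf

/-- As in `omega_shift_sub` with the halves exchanged: now z + a is unchanged and -z + a is raised
by 2η. -/
lemma omega_shift_add (lam u v z : ℂ) :
    br τ (-z + (lam + u - v) / 2 + 3 * (twoL / 2) * η)
        * (omega twoL η τ lam u v : ℂ → ℂ) (z + η)
      = br τ (-z + (lam + u - v) / 2 - twoL / 2 * η)
        * (omega twoL η τ lam (u + 2 * η) v : ℂ → ℂ) z := by
  have h := br_mul_brProd (η := η) (τ := τ) twoL (-z + (lam + u - v) / 2 - twoL / 2 * η)
  simp only [omega, brPair]
  rw [show -z + ((lam + (u + 2 * η) - v) / 2 + (-(twoL / 2) + 1) * η)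
      = -z + (lam + u - v) / 2 - twoL / 2 * η + 2 * η by ring, mul_left_comm (br _ (-z + _ - _)), h]
  ring_nf

lemma omega_neg (lam u v z : ℂ) :
    (omega twoL η τ lam u v : ℂ → ℂ) (-z) = (omega twoL η τ lam u v : ℂ → ℂ) z :=
  (omega twoL η τ lam u v).2.2.2.1 z

/-- Evenness reduces the backward shift at z to the forward shift at -z, so each shift formula
serves both terms of the operator. -/
lemma omega_sub (lam u v z : ℂ) :
    (omega twoL η τ lam u v : ℂ → ℂ) (z - η) = (omega twoL η τ lam u v : ℂ → ℂ) (-z + η) := by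
  rw [← omega_neg]
  ring_nf

/-! ### The local gauge transformation -/

/-- The entries of `M_{λ'}(v)⁻¹ L(u) f M_λ(v)`. -/
def gauged (twoL : ℕ) (η : ℂ) (τ : ℍ) (G H : Matrix (Fin 2) (Fin 2) ℂ) (u : ℂ)
    (f : thetaSpace twoL τ) (a b : Fin 2) : thetaSpace twoL τ :=
  ∑ c, ∑ d, (G a c * H d b) • lOp twoL η τ u c d f

/-- Since each coefficient matrix of L(u) has rank one, the double sum splits into a pairing with a
row of G times a pairing with a column of H. -/
lemma gauged_apply (hη : ∀ a, thetaIdx τ a η ≠ 0) (G H : Matrix (Fin 2) (Fin 2) ℂ) (u : ℂ)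
    (f : thetaSpace twoL τ) (a b : Fin 2) (z : ℂ) :
    br τ (2 * z) * (gauged twoL η τ G H u f a b : ℂ → ℂ) z
      = (∑ c, G a c * colVec τ (u / 2 - z + twoL / 2 * η) c)
          * (∑ d, rowVec τ (u / 2 + z - twoL / 2 * η) d * H d b) * (f : ℂ → ℂ) (z + η)
        - (∑ c, G a c * colVec τ (u / 2 + z + twoL / 2 * η) c)
          * (∑ d, rowVec τ (u / 2 - z - twoL / 2 * η) d * H d b) * (f : ℂ → ℂ) (z - η) := by
  have h := fun c d ↦ lOp_apply (twoL := twoL) hη u c d f z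
  have h2 : br τ (2 * z) * (gauged twoL η τ G H u f a b : ℂ → ℂ) z
      = ∑ c, ∑ d, (G a c * H d b) * (br τ (2 * z) * (lOp twoL η τ u c d f : ℂ → ℂ) z) := by
    simp only [gauged, Submodule.coe_sum, Submodule.coe_smul, Finset.sum_apply, Pi.smul_apply,
      smul_eq_mul, Finset.mul_sum]
    exact Finset.sum_congr rfl fun c _ ↦ Finset.sum_congr rfl fun d _ ↦ by ring
  rw [h2]
  simp only [h, Fin.sum_univ_two]
  ring

lemma ext_br_two_mul {f g : thetaSpace twoL τ}
    (h : ∀ z, br τ (2 * z) * (f : ℂ → ℂ) z = br τ (2 * z) * (g : ℂ → ℂ) z) : f = g :=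
  Subtype.ext (br_two_mul_cancel f.2.1 g.2.1 h)

lemma rowVec_dot_gaugeMatrix_zero (lam v x : ℂ) :
    ∑ d, rowVec τ x d * gaugeMatrix τ lam v d 0
      = -(2 * (br τ (x + (lam - v) / 2) * br τ (x - (lam - v) / 2))) := by
  simp only [gaugeMatrix_apply_zero, mul_neg, Finset.sum_neg_distrib, rowVec_dot_colVec]

lemma rowVec_dot_gaugeMatrix_one (lam v x : ℂ) :
    ∑ d, rowVec τ x d * gaugeMatrix τ lam v d 1
      = -(2 * (br τ (x + (lam + v) / 2) * br τ (x - (lam + v) / 2))) := by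
  simp only [gaugeMatrix_apply_one, mul_neg, Finset.sum_neg_distrib, rowVec_dot_colVec]

lemma gaugeMatrix_inv_zero_dot (lam v x : ℂ) :
    ∑ c, (gaugeMatrix τ lam v)⁻¹ 0 c * colVec τ x c
      = -((br τ lam * br τ v)⁻¹ * (br τ ((lam + v) / 2 + x) * br τ ((lam + v) / 2 - x))) := by
  simp only [gaugeMatrix_inv_zero, mul_assoc, ← Finset.mul_sum, rowVec_dot_colVec, inv_neg,
    mul_inv]
  ring

lemma gaugeMatrix_inv_one_dot (lam v x : ℂ) :
    ∑ c, (gaugeMatrix τ lam v)⁻¹ 1 c * colVec τ x c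
      = (br τ lam * br τ v)⁻¹ * (br τ ((lam - v) / 2 + x) * br τ ((lam - v) / 2 - x)) := by
  simp only [gaugeMatrix_inv_one, mul_assoc, ← Finset.mul_sum, rowVec_dot_colVec, mul_inv]
  ring

/-- The upper left entry of the gauge transformed local operator. -/
lemma gauged_zero_zero (hη : ∀ a, thetaIdx τ a η ≠ 0) {lam lam' v : ℂ}
    (hlam' : lam' = lam + 4 * (twoL / 2) * η) (hv : br τ v ≠ 0) (hl : br τ lam' ≠ 0) (u : ℂ) :
    gauged twoL η τ (gaugeMatrix τ lam' v)⁻¹ (gaugeMatrix τ lam v) u (omega twoL η τ lam u v) 0 0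
      = (2 * br τ (u + twoL * η)) • omega twoL η τ lam (u - 2 * η) v := by
  refine ext_br_two_mul fun z ↦ ?_
  have e1 := omega_shift_sub (twoL := twoL) (η := η) (τ := τ) lam u v z
  have e2 := omega_shift_sub (twoL := twoL) (η := η) (τ := τ) lam u v (-z)
  -- A and B are chosen to match `br_addition`: A - B + v = λ' and A + B = u + 2lη, so its right
  -- side supplies the eigenvalue bracket and cancels the inverse determinant.
  obtain ⟨A, hA⟩ : ∃ A, A = (lam + u - v) / 2 + 3 * (twoL / 2) * η := ⟨_, rfl⟩
  obtain ⟨B, hB⟩ : ∃ B, B = u / 2 - twoL / 2 * η - (lam - v) / 2 := ⟨_, rfl⟩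
  have h := br_addition τ A B v z
  have hk := inv_mul_cancel₀ (mul_ne_zero hl hv)
  rw [gauged_apply hη, gaugeMatrix_inv_zero_dot, gaugeMatrix_inv_zero_dot,
    rowVec_dot_gaugeMatrix_zero, rowVec_dot_gaugeMatrix_zero, omega_sub, Submodule.coe_smul,
    Pi.smul_apply, smul_eq_mul,
    show (lam' + v) / 2 + (u / 2 - z + twoL / 2 * η) = A + v - z by rw [hA, hlam']; ring,
    show (lam' + v) / 2 - (u / 2 - z + twoL / 2 * η) = v - B + z by rw [hB, hlam']; ring,
    show (lam' + v) / 2 + (u / 2 + z + twoL / 2 * η) = A + v + z by rw [hA, hlam']; ring,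
    show (lam' + v) / 2 - (u / 2 + z + twoL / 2 * η) = v - B - z by rw [hB, hlam']; ring,
    show u / 2 + z - twoL / 2 * η - (lam - v) / 2 = B + z by rw [hB]; ring,
    show u / 2 - z - twoL / 2 * η - (lam - v) / 2 = B - z by rw [hB]; ring,
    show u / 2 + z - twoL / 2 * η + (lam - v) / 2 = z + (lam + u - v) / 2 - twoL / 2 * η by ring,
    show u / 2 - z - twoL / 2 * η + (lam - v) / 2 = -z + (lam + u - v) / 2 - twoL / 2 * η by ring]
  rw [show z + (lam + u - v) / 2 + 3 * (twoL / 2) * η = A + z by rw [hA]; ring] at e1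
  rw [omega_neg, show -z + (lam + u - v) / 2 + 3 * (twoL / 2) * η = A - z by rw [hA]; ring] at e2
  rw [show A - B + v = lam' by rw [hA, hB, hlam']; ring,
    show A + B = u + twoL * η by rw [hA, hB]; ring] at h
  generalize (br τ lam' * br τ v)⁻¹ = k at hk ⊢
  -- `e1` and `e2` replace the two shifted values by the value of ω_λ(u - 2η; v) at z, `h` evaluates
  -- the remaining bracket difference, and `hk` removes the inverse.
  linear_combination 2 * k * br τ (A + v - z) * br τ (v - B + z) * br τ (B + z) * e1
    - 2 * k * br τ (A + v + z) * br τ (v - B - z) * br τ (B - z) * e2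
    + 2 * k * (omega twoL η τ lam (u - 2 * η) v : ℂ → ℂ) z * h
    + 2 * (omega twoL η τ lam (u - 2 * η) v : ℂ → ℂ) z * br τ (2 * z) * br τ (u + twoL * η) * hk

/-- The lower left entry of the gauge transformed local operator vanishes. -/
lemma gauged_one_zero (hη : ∀ a, thetaIdx τ a η ≠ 0) {lam lam' v : ℂ}
    (hlam' : lam' = lam + 4 * (twoL / 2) * η) (u : ℂ) :
    gauged twoL η τ (gaugeMatrix τ lam' v)⁻¹ (gaugeMatrix τ lam v) u (omega twoL η τ lam u v) 1 0
      = 0 := by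
  refine ext_br_two_mul fun z ↦ ?_
  have e1 := omega_shift_add (twoL := twoL) (η := η) (τ := τ) lam u v z
  have e2 := omega_shift_add (twoL := twoL) (η := η) (τ := τ) lam u v (-z)
  rw [neg_neg, omega_neg] at e2
  obtain ⟨B, hB⟩ : ∃ B, B = u / 2 - twoL / 2 * η - (lam - v) / 2 := ⟨_, rfl⟩
  rw [gauged_apply hη, gaugeMatrix_inv_one_dot, gaugeMatrix_inv_one_dot,
    rowVec_dot_gaugeMatrix_zero, rowVec_dot_gaugeMatrix_zero, omega_sub, Submodule.coe_zero,
    Pi.zero_apply, mul_zero,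
    show (lam' - v) / 2 + (u / 2 - z + twoL / 2 * η)
      = -z + (lam + u - v) / 2 + 3 * (twoL / 2) * η by rw [hlam']; ring,
    show (lam' - v) / 2 - (u / 2 - z + twoL / 2 * η) = -(B - z) by rw [hB, hlam']; ring,
    show (lam' - v) / 2 + (u / 2 + z + twoL / 2 * η)
      = z + (lam + u - v) / 2 + 3 * (twoL / 2) * η by rw [hlam']; ring,
    show (lam' - v) / 2 - (u / 2 + z + twoL / 2 * η) = -(B + z) by rw [hB, hlam']; ring,
    show u / 2 + z - twoL / 2 * η - (lam - v) / 2 = B + z by rw [hB]; ring,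
    show u / 2 - z - twoL / 2 * η - (lam - v) / 2 = B - z by rw [hB]; ring,
    show u / 2 + z - twoL / 2 * η + (lam - v) / 2 = z + (lam + u - v) / 2 - twoL / 2 * η by ring,
    show u / 2 - z - twoL / 2 * η + (lam - v) / 2 = -z + (lam + u - v) / 2 - twoL / 2 * η by ring,
    br_neg, br_neg]
  generalize (br τ lam' * br τ v)⁻¹ = k
  -- After the two shift formulas both terms are the same product, symmetric under z ↦ -z, and their
  -- difference is zero.
  linear_combination 2 * k * br τ (B - z) * br τ (B + z) *
    (br τ (z + (lam + u - v) / 2 - twoL / 2 * η) * e1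
      - br τ (-z + (lam + u - v) / 2 - twoL / 2 * η) * e2)

/-- The lower right entry of the gauge transformed local operator. -/
lemma gauged_one_one (hη : ∀ a, thetaIdx τ a η ≠ 0) {lam lam' v : ℂ}
    (hlam' : lam' = lam + 4 * (twoL / 2) * η) (hv : br τ v ≠ 0) (hl : br τ lam' ≠ 0) (u : ℂ) :
    gauged twoL η τ (gaugeMatrix τ lam' v)⁻¹ (gaugeMatrix τ lam v) u (omega twoL η τ lam u v) 1 1
      = ((br τ lam')⁻¹ * br τ lam * (2 * br τ (u - twoL * η))) •
        omega twoL η τ lam (u + 2 * η) v := by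
  refine ext_br_two_mul fun z ↦ ?_
  have e1 := omega_shift_add (twoL := twoL) (η := η) (τ := τ) lam u v z
  have e2 := omega_shift_add (twoL := twoL) (η := η) (τ := τ) lam u v (-z)
  rw [neg_neg, omega_neg] at e2
  -- Here E - B + v = λ and E + B = u - 2lη. The bracket [λ] therefore comes from `br_addition`,
  -- while [λ'] survives from the inverse determinant; conjugation by X will account for this ratio.
  obtain ⟨E, hE⟩ : ∃ E, E = (lam + u - v) / 2 - twoL / 2 * η := ⟨_, rfl⟩
  obtain ⟨B, hB⟩ : ∃ B, B = u / 2 - twoL / 2 * η - (lam - v) / 2 := ⟨_, rfl⟩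
  have h := br_addition τ E B v z
  have hk := inv_mul_cancel₀ hl
  have hk' := inv_mul_cancel₀ hv
  rw [gauged_apply hη, gaugeMatrix_inv_one_dot, gaugeMatrix_inv_one_dot,
    rowVec_dot_gaugeMatrix_one, rowVec_dot_gaugeMatrix_one, omega_sub, Submodule.coe_smul,
    Pi.smul_apply, smul_eq_mul, mul_inv,
    show (lam' - v) / 2 + (u / 2 - z + twoL / 2 * η)
      = -z + (lam + u - v) / 2 + 3 * (twoL / 2) * η by rw [hlam']; ring,
    show (lam' - v) / 2 - (u / 2 - z + twoL / 2 * η) = -(B - z) by rw [hB, hlam']; ring,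
    show (lam' - v) / 2 + (u / 2 + z + twoL / 2 * η)
      = z + (lam + u - v) / 2 + 3 * (twoL / 2) * η by rw [hlam']; ring,
    show (lam' - v) / 2 - (u / 2 + z + twoL / 2 * η) = -(B + z) by rw [hB, hlam']; ring,
    show u / 2 + z - twoL / 2 * η - (lam + v) / 2 = -(v - B - z) by rw [hB]; ring,
    show u / 2 - z - twoL / 2 * η - (lam + v) / 2 = -(v - B + z) by rw [hB]; ring,
    show u / 2 + z - twoL / 2 * η + (lam + v) / 2 = E + v + z by rw [hE]; ring,
    show u / 2 - z - twoL / 2 * η + (lam + v) / 2 = E + v - z by rw [hE]; ring,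
    br_neg, br_neg, br_neg, br_neg]
  rw [show -z + (lam + u - v) / 2 - twoL / 2 * η = E - z by rw [hE]; ring] at e1
  rw [show z + (lam + u - v) / 2 - twoL / 2 * η = E + z by rw [hE]; ring] at e2
  rw [show E - B + v = lam by rw [hE, hB]; ring,
    show E + B = u - twoL * η by rw [hE, hB]; ring] at h
  generalize (br τ lam')⁻¹ = k at hk ⊢
  generalize (br τ v)⁻¹ = k' at hk' ⊢
  linear_combination -2 * k * k' * br τ (B - z) * br τ (v - B - z) * br τ (E + v + z) * e1
    + 2 * k * k' * br τ (B + z) * br τ (v - B + z) * br τ (E + v - z) * e2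
    + 2 * k * k' * (omega twoL η τ lam (u + 2 * η) v : ℂ → ℂ) z * h
    + 2 * k * (omega twoL η τ lam (u + 2 * η) v : ℂ → ℂ) z * br τ (2 * z) * br τ lam
      * br τ (u - twoL * η) * hk'

end Parameters

/-! ### Traces over the sites -/

section SiteTrace

variable {I U V : Type*} [Fintype I] [AddCommGroup U] [Module ℂ U] [AddCommGroup V] [Module ℂ V]

/-- This form makes the multilinearity of the tensor product of maps available to the following
lemmas. -/
lemma siteTrace_eq (N : ℕ) (S : Matrix I I (U →ₗ[ℂ] V)) :
    siteTrace N S = ∑ i : Fin N → I, PiTensorProduct.mapMultilinear ℂ (fun _ : Fin N ↦ U)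
      (fun _ ↦ V) fun n ↦ S (i n) (i ((finRotate N).symm n)) := rfl

lemma siteTrace_smul (N : ℕ) (k : ℂ) (S : Matrix I I (U →ₗ[ℂ] V)) :
    siteTrace N (k • S) = k ^ N • siteTrace N S := by
  simp only [siteTrace_eq, Matrix.smul_apply, MultilinearMap.map_smul_univ, Finset.prod_const,
    Finset.card_univ, Fintype.card_fin, Finset.smul_sum]

lemma siteTrace_submatrix {J : Type*} [Fintype J] (N : ℕ) (e : J ≃ I)
    (S : Matrix I I (U →ₗ[ℂ] V)) : siteTrace N (S.submatrix e e) = siteTrace N S :=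
  Fintype.sum_equiv (Equiv.arrowCongr (Equiv.refl _) e) _ _ fun _ ↦ rfl

/-- The trace over the sites is invariant under conjugation. -/
lemma siteTrace_sandwich [DecidableEq I] (N : ℕ) {A C : Matrix I I ℂ} (hCA : C * A = 1)
    (S : Matrix I I (U →ₗ[ℂ] V)) : siteTrace N (sandwich A S C) = siteTrace N S := by
  let φ := PiTensorProduct.mapMultilinear ℂ (fun _ : Fin N ↦ U) (fun _ ↦ V)
  let ρ := finRotate N
  have h1 : ∀ i : Fin N → I,
      φ (fun n ↦ sandwich A S C (i n) (i (ρ.symm n)))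
        = ∑ k : Fin N → I × I, (∏ n, A (i n) (k n).1 * C (k n).2 (i (ρ.symm n))) •
          φ fun n ↦ S (k n).1 (k n).2 := by
    intro i
    have : ∀ n, sandwich A S C (i n) (i (ρ.symm n))
        = ∑ x : I × I, (A (i n) x.1 * C x.2 (i (ρ.symm n))) • S x.1 x.2 := fun n ↦ by
      rw [sandwich, Matrix.of_apply, Fintype.sum_prod_type]
    simp only [this]
    rw [φ.map_sum]
    refine Finset.sum_congr rfl fun k _ ↦ ?_
    rw [φ.map_smul_univ]
  have h2 : ∀ k : Fin N → I × I,
      ∑ i : Fin N → I, ∏ n, A (i n) (k n).1 * C (k n).2 (i (ρ.symm n))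
        = if (fun n ↦ (k n).2) = fun n ↦ (k (ρ.symm n)).1 then 1 else 0 := by
    intro k
    -- The factor A of each site is paired with the factor C of the next one, with which it shares
    -- the summation index. Summing over that index gives an entry of C A = 1.
    have h3 : ∀ i : Fin N → I, ∏ n, A (i n) (k n).1 * C (k n).2 (i (ρ.symm n))
        = ∏ n, C (k n).2 (i (ρ.symm n)) * A (i (ρ.symm n)) (k (ρ.symm n)).1 := fun i ↦ by
      rw [Finset.prod_mul_distrib, Finset.prod_mul_distrib, mul_comm]
      congr 1
      exact (Equiv.prod_comp ρ.symm fun n ↦ A (i n) (k n).1).symm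
    simp only [h3]
    refine (Fintype.sum_equiv (Equiv.arrowCongr ρ (Equiv.refl I)) _
      (fun i ↦ ∏ n, C (k n).2 (i n) * A (i n) (k (ρ.symm n)).1) fun _ ↦ rfl).trans ?_
    rw [← Fintype.prod_sum fun n j ↦ C (k n).2 j * A j (k (ρ.symm n)).1]
    simp only [← Matrix.mul_apply, hCA, Matrix.one_apply, Finset.prod_ite_zero, funext_iff]
    simp
  rw [siteTrace_eq, siteTrace_eq]
  change ∑ i : Fin N → I, φ (fun n ↦ sandwich A S C (i n) (i (ρ.symm n)))
    = ∑ i : Fin N → I, φ fun n ↦ S (i n) (i (ρ.symm n))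
  simp only [h1]
  rw [Finset.sum_comm]
  simp only [← Finset.sum_smul, h2, ite_smul, one_smul, zero_smul]
  rw [← Finset.sum_filter]
  -- In a surviving term the second index at each site equals the first index at its predecessor, so
  -- the first components determine everything.
  refine Finset.sum_bij' (fun k _ n ↦ (k n).1) (fun i _ n ↦ (i n, i (ρ.symm n)))
    (by simp) (by simp) ?_ (by simp) ?_
  · intro k hk
    simp only [Finset.mem_filter, Finset.mem_univ, true_and] at hk
    funext n
    exact Prod.ext rfl (congrFun hk n).symm
  · intro k hk
    simp only [Finset.mem_filter, Finset.mem_univ, true_and] at hk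
    congr 1
    funext n
    exact congrArg (S (k n).1) (congrFun hk n)

/-- The rotation acts transitively: n is reached from m after n - m steps. -/
lemma forall_of_finRotate {N : ℕ} {p : Fin N → Prop} (h : ∀ n, p ((finRotate N).symm n) → p n)
    {m : Fin N} (hm : p m) (n : Fin N) : p n := by
  have := m.neZero
  have h1 : ∀ k : ℕ, p (m + Fin.ofNat N k) := by
    intro k
    induction k with
    | zero => simpa using hm
    | succ k ih =>
      refine h _ ?_
      rw [finRotate_symm_apply]
      convert ih using 1
      rw [sub_eq_iff_eq_add, add_assoc]
      congr 1
      ext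
      simp [Fin.val_add]
  have h2 := h1 (n - m : Fin N)
  rwa [Fin.ofNat_val_eq_self, add_sub_cancel] at h2

/-- The trace over the sites of a block triangular matrix. -/
lemma siteTrace_fromBlocks {N : ℕ} (hN : 0 < N) (A B D : Matrix I I (U →ₗ[ℂ] V)) :
    siteTrace N (Matrix.fromBlocks A B 0 D) = siteTrace N A + siteTrace N D := by
  classical
  have : Nonempty (Fin N) := ⟨⟨0, hN⟩⟩
  have hinl : Function.Injective fun (i : Fin N → I) n ↦ (Sum.inl (i n) : I ⊕ I) :=
    fun i j h ↦ funext fun n ↦ Sum.inl_injective (congrFun h n)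
  have hinr : Function.Injective fun (i : Fin N → I) n ↦ (Sum.inr (i n) : I ⊕ I) :=
    fun i j h ↦ funext fun n ↦ Sum.inr_injective (congrFun h n)
  -- Positivity of N is essential: for N = 0 the only configuration is empty and would be counted in
  -- both blocks.
  have hdisj : Disjoint (Finset.univ.map ⟨_, hinl⟩) (Finset.univ.map ⟨_, hinr⟩) := by
    rw [Finset.disjoint_left]
    rintro i hi hj
    simp only [Finset.mem_map, Finset.mem_univ, true_and, Function.Embedding.coeFn_mk] at hi hj
    obtain ⟨j, rfl⟩ := hi
    obtain ⟨k, hk⟩ := hj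
    exact absurd (congrFun hk ⟨0, hN⟩) (by simp)
  rw [siteTrace_eq, siteTrace_eq, siteTrace_eq,
    ← Finset.sum_subset (Finset.subset_univ
      ((Finset.univ.map ⟨_, hinl⟩).disjUnion (Finset.univ.map ⟨_, hinr⟩) hdisj)),
    Finset.sum_disjUnion, Finset.sum_map, Finset.sum_map]
  · rfl
  · intro i _ hi
    by_contra h0
    -- A passage from left at the preceding site to right at site n would select the zero lower left
    -- block. A nonzero term is therefore left at every site or right at every site, because the
    -- sites form a cycle.
    have hstep : ∀ n, (i ((finRotate N).symm n)).isLeft → (i n).isLeft := by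
      intro n hn
      by_contra hn'
      refine h0 (MultilinearMap.map_coord_zero _ n ?_)
      obtain ⟨x, hx⟩ := Sum.isLeft_iff.1 hn
      obtain ⟨y, hy⟩ := Sum.isRight_iff.1 (Sum.not_isLeft.1 hn')
      rw [hx, hy, Matrix.fromBlocks_apply₂₁]
      rfl
    refine hi ?_
    simp only [Finset.mem_disjUnion, Finset.mem_map, Finset.mem_univ, true_and,
      Function.Embedding.coeFn_mk]
    by_cases hex : ∃ m, (i m).isLeft
    · obtain ⟨m, hm⟩ := hex
      left
      have hall := forall_of_finRotate (p := fun n ↦ ((i n).isLeft : Prop)) hstep hm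
      choose j hj using fun n ↦ Sum.isLeft_iff.1 (hall n)
      exact ⟨j, funext fun n ↦ (hj n).symm⟩
    · right
      push Not at hex
      choose j hj using fun n ↦ Sum.isRight_iff.1 (Sum.not_isLeft.1 (hex n))
      exact ⟨j, funext fun n ↦ (hj n).symm⟩

end SiteTrace

/-! ### The transfer matrix as a trace over the sites -/

/-- The entries of an ordered product of matrices as sums over paths. -/
lemma reverse_prod_apply {R J : Type*} [Semiring R] [Fintype J] [DecidableEq J] (N : ℕ)
    (A : Fin N → Matrix J J R) (a b : J) :
    (List.ofFn A).reverse.prod a b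
      = ∑ j : Fin N → J, if (Fin.cons b j : Fin (N + 1) → J) (Fin.last N) = a then
          (List.ofFn fun n ↦ A n (j n) ((Fin.cons b j : Fin (N + 1) → J) n.castSucc)).reverse.prod
        else 0 := by
  induction N generalizing a with
  | zero => simp [Matrix.one_apply, eq_comm, Fin.last]
  | succ N ih =>
    rw [List.ofFn_succ', List.concat_eq_append, List.reverse_append, List.reverse_singleton,
      List.singleton_append, List.prod_cons, Matrix.mul_apply,
      -- The leftmost factor belongs to the last site, so the induction splits off the last index of
      -- the path.
      ← (Fin.snocEquiv fun _ : Fin (N + 1) ↦ J).sum_comp, Fintype.sum_prod_type]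
    simp only [ih, Fin.snocEquiv, Equiv.coe_fn_mk, Finset.mul_sum]
    have hlast : ∀ (x : J) (j : Fin N → J),
        (Fin.cons b (Fin.snoc j x : Fin (N + 1) → J) : Fin (N + 2) → J) (Fin.last (N + 1)) = x :=
      fun x j ↦ by rw [Fin.cons_snoc_eq_snoc_cons, Fin.snoc_last]
    have hcast : ∀ (x : J) (j : Fin N → J) (n : Fin (N + 1)),
        (Fin.cons b (Fin.snoc j x : Fin (N + 1) → J) : Fin (N + 2) → J) n.castSucc
          = (Fin.cons b j : Fin (N + 1) → J) n :=
      fun x j n ↦ by rw [Fin.cons_snoc_eq_snoc_cons, Fin.snoc_castSucc]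
    have hterm : ∀ (x : J) (j : Fin N → J),
        (List.ofFn fun n ↦ A n ((Fin.snoc j x : Fin (N + 1) → J) n)
          ((Fin.cons b (Fin.snoc j x : Fin (N + 1) → J) : Fin (N + 2) → J)
            n.castSucc)).reverse.prod
          = A (Fin.last N) x ((Fin.cons b j : Fin (N + 1) → J) (Fin.last N)) *
            (List.ofFn fun n : Fin N ↦ A n.castSucc (j n)
              ((Fin.cons b j : Fin (N + 1) → J) n.castSucc)).reverse.prod := fun x j ↦ by
      rw [List.ofFn_succ', List.concat_eq_append, List.reverse_append, List.reverse_singleton,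
        List.singleton_append, List.prod_cons]
      simp only [hcast, Fin.snoc_last, Fin.snoc_castSucc]
    simp only [hlast, hterm]
    rw [Finset.sum_comm, Finset.sum_comm (s := Finset.univ (α := J))]
    refine Finset.sum_congr rfl fun j _ ↦ ?_
    simp

/-- Taking the trace closes the paths: the initial index becomes the index at the last site, which
is the cyclic predecessor of the first. The order of the factors is kept, as the entries need not
commute. -/
lemma trace_reverse_prod {R J : Type*} [Semiring R] [Fintype J] [DecidableEq J] {N : ℕ} (hN : 0 < N)
    (A : Fin N → Matrix J J R) :
    (List.ofFn A).reverse.prod.trace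
      = ∑ j : Fin N → J,
          (List.ofFn fun n ↦ A n (j n) (j ((finRotate N).symm n))).reverse.prod := by
  obtain ⟨M, rfl⟩ := Nat.exists_eq_add_one_of_ne_zero hN.ne'
  simp only [Matrix.trace, Matrix.diag, reverse_prod_apply]
  rw [Finset.sum_comm]
  refine Finset.sum_congr rfl fun j _ ↦ ?_
  have hlast : ∀ b, (Fin.cons b j : Fin (M + 2) → J) (Fin.last (M + 1)) = j (Fin.last M) :=
    fun b ↦ by rw [← Fin.succ_last, Fin.cons_succ]
  simp only [hlast]
  rw [Finset.sum_ite_eq]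
  simp only [Finset.mem_univ, if_true]
  congr 3
  funext n
  congr 1
  refine Fin.cases ?_ (fun m ↦ ?_) n
  · rw [Fin.castSucc_zero, Fin.cons_zero]
    congr 1
  · rw [Fin.castSucc_succ, Fin.cons_succ]
    congr 1
    rw [Equiv.eq_symm_apply, finRotate_apply, Fin.coeSucc_eq_succ]

variable {N twoL : ℕ} {τ : ℍ}

/-- A tensor product of maps multiplies site by site, and without repetition each site receives at
most one nontrivial factor. -/
lemma atSite_list_prod (X : Fin N → Module.End ℂ (thetaSpace twoL τ)) (s : List (Fin N))
    (hs : s.Nodup) :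
    (s.map fun n ↦ atSite n (X n)).prod
      = PiTensorProduct.map fun n ↦ if n ∈ s then X n else LinearMap.id := by
  induction s with
  | nil =>
    simp only [List.map_nil, List.prod_nil, List.not_mem_nil, if_false]
    exact PiTensorProduct.map_id.symm
  | cons m s ih =>
    rw [List.nodup_cons] at hs
    rw [List.map_cons, List.prod_cons, ih hs.2, atSite, ← PiTensorProduct.map_mul]
    congr 1
    funext n
    by_cases hn : n = m
    · subst hn
      simp only [Function.update_self, hs.1, if_false, List.mem_cons, true_or, if_true]
      exact mul_one _
    · simp only [ne_eq, hn, not_false_eq_true, Function.update_of_ne, List.mem_cons, false_or]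
      exact one_mul _

/-- Placing an operator at one site is linear in it, being one slot of a multilinear map. -/
lemma lSite_apply (η : ℂ) (n : Fin N) (u : ℂ) (i j : Fin 2) :
    lSite N twoL η τ n u i j = atSite n (lOp twoL η τ u i j) := by
  have h : ∀ X : Module.End ℂ (thetaSpace twoL τ), atSite n X
      = (PiTensorProduct.mapMultilinear ℂ (fun _ : Fin N ↦ thetaSpace twoL τ)
        (fun _ ↦ thetaSpace twoL τ)).toLinearMap (fun _ ↦ LinearMap.id) n X := fun X ↦ rfl
  rw [h, lOp, lSite, Matrix.of_apply, Matrix.of_apply, map_sum]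
  refine Finset.sum_congr rfl fun a _ ↦ ?_
  rw [map_smul, h]

/-- This gives T(u) the same form as Q_R(u), so that their composition can be taken site by site. -/
lemma transferMatrix_eq (hN : 0 < N) (η u : ℂ) :
    transferMatrix N twoL η τ u = siteTrace N (lOp twoL η τ u) := by
  rw [transferMatrix, trace_reverse_prod hN, siteTrace]
  refine Finset.sum_congr rfl fun j _ ↦ ?_
  simp only [lSite_apply]
  have h := atSite_list_prod (fun n ↦ lOp twoL η τ u (j n) (j ((finRotate N).symm n)))
    (List.finRange N).reverse (List.nodup_reverse.2 (List.nodup_finRange N))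
  rw [List.map_reverse, ← List.ofFn_eq_map] at h
  rw [h]
  simp

/-- Two independent cyclic sums are one cyclic sum over pairs of indices, and tensor products of
maps compose at each site. -/
lemma siteTrace_comp {I U V : Type*} [Fintype I] [AddCommGroup U] [Module ℂ U] [AddCommGroup V]
    [Module ℂ V] (N : ℕ) (L : Matrix (Fin 2) (Fin 2) (Module.End ℂ V))
    (S : Matrix I I (U →ₗ[ℂ] V)) :
    siteTrace N L ∘ₗ siteTrace N S = siteTrace N (tensorMat L S) := by
  have h : siteTrace N L ∘ₗ siteTrace N S = ∑ i : Fin N → Fin 2, ∑ j : Fin N → I,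
      (PiTensorProduct.map fun n ↦ L (i n) (i ((finRotate N).symm n))) ∘ₗ
        PiTensorProduct.map fun n ↦ S (j n) (j ((finRotate N).symm n)) := by
    refine LinearMap.ext fun x ↦ ?_
    simp only [siteTrace, LinearMap.comp_apply, LinearMap.sum_apply, map_sum]
    exact Finset.sum_comm
  rw [h, siteTrace]
  rw [← (Equiv.arrowProdEquivProdArrow (Fin N) (fun _ ↦ Fin 2) fun _ ↦ I).symm.sum_comp,
    Fintype.sum_prod_type]
  refine Finset.sum_congr rfl fun i _ ↦ Finset.sum_congr rfl fun j _ ↦ ?_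
  rw [← PiTensorProduct.map_comp]
  rfl

/-! ### The gauge transformation of `L ⊗ S` -/

section Gauge

variable {twoL r : ℕ} {η : ℂ} {τ : ℍ} {lam₀ v : ℂ}

lemma gaugeBlock_apply (x y : Fin 2 × Fin (2 * r)) :
    gaugeBlock twoL r η τ lam₀ v x y
      = if x.2 = y.2 then gaugeMatrix τ (lamAt twoL η lam₀ x.2) v x.1 y.1 else 0 := by
  rw [gaugeBlock, Matrix.sum_apply]
  simp only [Matrix.kroneckerMap_apply, Matrix.single_apply]
  rw [Finset.sum_eq_single x.2]
  · simp
  · intro i _ hi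
    simp [hi]
  · simp

lemma gaugeBlock_mul (hv : br τ v ≠ 0)
    (hlam : ∀ i : Fin (2 * r), br τ (lamAt twoL η lam₀ i) ≠ 0) :
    gaugeBlock twoL r η τ lam₀ v * Matrix.of (fun x y ↦ if x.2 = y.2 then
      (gaugeMatrix τ (lamAt twoL η lam₀ x.2) v)⁻¹ x.1 y.1 else 0) = 1 := by
  ext ⟨a, i⟩ ⟨b, j⟩
  rw [Matrix.mul_apply, Fintype.sum_prod_type]
  simp only [gaugeBlock_apply, Matrix.of_apply, ite_mul, zero_mul, mul_ite, mul_zero]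
  by_cases hij : i = j
  · subst hij
    have h := congrFun (congrFun (Matrix.mul_nonsing_inv _
      (isUnit_det_gaugeMatrix (hlam i) hv)) a) b
    rw [Matrix.mul_apply] at h
    simpa [Matrix.one_apply] using h
  · simp [hij]

lemma gaugeBlock_inv_apply (hv : br τ v ≠ 0)
    (hlam : ∀ i : Fin (2 * r), br τ (lamAt twoL η lam₀ i) ≠ 0) (x y : Fin 2 × Fin (2 * r)) :
    (gaugeBlock twoL r η τ lam₀ v)⁻¹ x y = if x.2 = y.2 then
      (gaugeMatrix τ (lamAt twoL η lam₀ x.2) v)⁻¹ x.1 y.1 else 0 := by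
  rw [Matrix.inv_eq_right_inv (gaugeBlock_mul hv hlam), Matrix.of_apply]

lemma isUnit_gaugeBlock (hv : br τ v ≠ 0)
    (hlam : ∀ i : Fin (2 * r), br τ (lamAt twoL η lam₀ i) ≠ 0) :
    IsUnit (gaugeBlock twoL r η τ lam₀ v) :=
  IsUnit.of_mul_eq_one _ (gaugeBlock_mul hv hlam)

/-- The operator `f ↦ (G L(u) f H)_{ab}` on `Θ₀₀^{4l+}`. -/
def gaugedEnd (twoL : ℕ) (η : ℂ) (τ : ℍ) (G H : Matrix (Fin 2) (Fin 2) ℂ) (u : ℂ)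
    (a b : Fin 2) : Module.End ℂ (thetaSpace twoL τ) :=
  ∑ c, ∑ d, (G a c * H d b) • lOp twoL η τ u c d

lemma gaugedEnd_apply (G H : Matrix (Fin 2) (Fin 2) ℂ) (u : ℂ) (a b : Fin 2)
    (f : thetaSpace twoL τ) : gaugedEnd twoL η τ G H u a b f = gauged twoL η τ G H u f a b := by
  simp only [gaugedEnd, gauged, LinearMap.sum_apply, LinearMap.smul_apply]

/-- M is block diagonal in the second index, so only the gauge matrices at i and j enter this block.
-/
lemma sandwich_gaugeBlock_apply {U : Type*} [AddCommGroup U] [Module ℂ U] (hv : br τ v ≠ 0)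
    (hlam : ∀ i : Fin (2 * r), br τ (lamAt twoL η lam₀ i) ≠ 0) (u : ℂ)
    (S : Matrix (Fin (2 * r)) (Fin (2 * r)) (U →ₗ[ℂ] thetaSpace twoL τ)) (a b : Fin 2)
    (i j : Fin (2 * r)) :
    sandwich (gaugeBlock twoL r η τ lam₀ v)⁻¹ (tensorMat (lOp twoL η τ u) S)
        (gaugeBlock twoL r η τ lam₀ v) (a, i) (b, j)
      = gaugedEnd twoL η τ (gaugeMatrix τ (lamAt twoL η lam₀ i) v)⁻¹
          (gaugeMatrix τ (lamAt twoL η lam₀ j) v) u a b ∘ₗ S i j := by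
  simp only [sandwich, Matrix.of_apply, gaugeBlock_inv_apply hv hlam, gaugeBlock_apply,
    Fintype.sum_prod_type, tensorMat]
  refine LinearMap.ext fun x ↦ ?_
  simp only [gaugedEnd, LinearMap.comp_apply, LinearMap.sum_apply, LinearMap.smul_apply]
  refine Finset.sum_congr rfl fun c _ ↦ ?_
  rw [Finset.sum_eq_single i]
  · refine Finset.sum_congr rfl fun d _ ↦ ?_
    rw [Finset.sum_eq_single j]
    · simp
    · intro k _ hk
      simp [hk]
    · simp
  · intro k _ hk
    simp [hk.symm]
  · simp

/-- All basis vectors go to multiples of one vector, so a single relation for that vector suffices,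
whatever the parameters `t`. -/
lemma comp_ofBasis {X : Module.End ℂ (thetaSpace twoL τ)} {f g : thetaSpace twoL τ} {k : ℂ}
    (h : X f = k • g) (t : Fin (twoL + 1) → ℂ) :
    X ∘ₗ ofBasis (fun m ↦ t m • f) = k • ofBasis fun m ↦ t m • g := by
  refine LinearMap.ext fun x ↦ ?_
  simp only [ofBasis, LinearMap.comp_apply, LinearMap.smul_apply,
    Fintype.linearCombination_apply, map_sum, map_smul, h, Finset.smul_sum]
  refine Finset.sum_congr rfl fun m _ ↦ ?_
  rw [smul_comm (t m) k, smul_comm (x m) k]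

/-- The parameters `λ₀ + 4 i'' l η` at cyclically neighbouring indices. -/
lemma lamAt_of_modEq {r' : ℤ} (hη : twoL * r * η = r') {i j : Fin (2 * r)}
    (h : (i : ℕ) ≡ (j : ℕ) + 1 [MOD 2 * r]) :
    ∃ m : ℤ, lamAt twoL η lam₀ i = lamAt twoL η lam₀ j + 4 * (twoL / 2) * η + m * 2 := by
  obtain ⟨q, hq⟩ := (Nat.modEq_iff_dvd.1 h.symm)
  -- Each turn of 2r indices adds 2r · 4lη = 4r', so q turns add 4qr' = 2(2qr').
  refine ⟨2 * q * r', ?_⟩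
  have hq' : ((i : ℕ) : ℂ) - ((j : ℕ) + 1) = 2 * r * q := by exact_mod_cast hq
  rw [lamAt, lamAt]
  push_cast
  linear_combination 2 * twoL * η * hq' + 4 * q * hη

/-- The entries of `M⁻¹ (L(u) ⊗ S(u)) M` are determined by the action of the gauge transformed
local operators on the local vectors. -/
lemma gaugedEnd_comp_sMatrix {r' : ℤ} (hη' : twoL * r * η = r')
    (c : Fin (twoL + 1) → Fin (2 * r) → ℂ) (u w : ℂ) {a b : Fin 2} {i j : Fin (2 * r)} {k : ℂ}
    (hpos : ∀ m : ℤ, lamAt twoL η lam₀ i = lamAt twoL η lam₀ j + 4 * (twoL / 2) * η + m * 2 →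
      gauged twoL η τ (gaugeMatrix τ (lamAt twoL η lam₀ j + 4 * (twoL / 2) * η) v)⁻¹
        (gaugeMatrix τ (lamAt twoL η lam₀ j) v) u (omega twoL η τ (lamAt twoL η lam₀ j) u v) a b
        = k • omega twoL η τ (lamAt twoL η lam₀ j) w v)
    (hneg : ∀ m : ℤ, -lamAt twoL η lam₀ i = -lamAt twoL η lam₀ j + 4 * (twoL / 2) * η + m * 2 →
      gauged twoL η τ (gaugeMatrix τ (-lamAt twoL η lam₀ j + 4 * (twoL / 2) * η) (-v))⁻¹
        (gaugeMatrix τ (-lamAt twoL η lam₀ j) (-v)) u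
        (omega twoL η τ (-lamAt twoL η lam₀ j) u (-v)) a b
        = k • omega twoL η τ (-lamAt twoL η lam₀ j) w (-v)) :
    gaugedEnd twoL η τ (gaugeMatrix τ (lamAt twoL η lam₀ i) v)⁻¹
        (gaugeMatrix τ (lamAt twoL η lam₀ j) v) u a b ∘ₗ sMatrix twoL r η τ lam₀ v c u i j
      = k • sMatrix twoL r η τ lam₀ v c w i j := by
  rw [sMatrix, sMatrix, Matrix.of_apply, Matrix.of_apply]
  -- For r = 1 the two congruences are equivalent, and the first branch is the one taken.
  split_ifs with h1 h2
  · obtain ⟨m, hm⟩ := lamAt_of_modEq (lam₀ := lam₀) hη' h1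
    refine comp_ofBasis ?_ _
    rw [gaugedEnd_apply, ← hpos m hm, hm]
    congr 2
    exact (gaugeMatrix_periodic v).int_mul m _
  · obtain ⟨m, hm⟩ := lamAt_of_modEq (lam₀ := lam₀) hη' h2.symm
    -- Negation exchanges the roles of i and j: the lowering step becomes a step by +4lη between the
    -- negated parameters.
    have hm' : -lamAt twoL η lam₀ i = -lamAt twoL η lam₀ j + 4 * (twoL / 2) * η + m * 2 := by
      linear_combination hm
    refine comp_ofBasis ?_ _
    rw [gaugedEnd_apply, ← hneg m hm', ← gaugeMatrix_neg (lamAt twoL η lam₀ i),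
      ← gaugeMatrix_neg (lamAt twoL η lam₀ j), hm']
    congr 2
    exact (gaugeMatrix_periodic (-v)).int_mul m _
  · rw [LinearMap.comp_zero, smul_zero]

lemma xMatrix_inv (hlam : ∀ i : Fin (2 * r), br τ (lamAt twoL η lam₀ i) ≠ 0) :
    xMatrix twoL r η τ lam₀ * Matrix.diagonal (fun i ↦ (br τ (lamAt twoL η lam₀ i))⁻¹) = 1 := by
  rw [xMatrix, Matrix.diagonal_mul_diagonal, ← Matrix.diagonal_one]
  congr 1
  funext i
  exact mul_inv_cancel₀ (hlam i)

lemma sandwich_diagonal_apply {J W : Type*} [Fintype J] [DecidableEq J] [AddCommGroup W]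
    [Module ℂ W] (x y : J → ℂ) (S : Matrix J J W) (i j : J) :
    sandwich (Matrix.diagonal x) S (Matrix.diagonal y) i j = (x i * y j) • S i j := by
  rw [sandwich, Matrix.of_apply, Finset.sum_eq_single i, Finset.sum_eq_single j]
  · simp
  · intro k _ hk
    simp [Matrix.diagonal_apply_ne _ hk]
  · simp
  · intro k _ hk
    simp [Matrix.diagonal_apply_ne' _ hk]
  · simp

/-- The gauge transformation makes `L(u) ⊗ S(u)` block triangular. -/
lemma sandwich_gaugeBlock_eq {r' : ℤ} (hη' : twoL * r * η = r')
    (hη : ∀ a, thetaIdx τ a η ≠ 0) (hv : br τ v ≠ 0)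
    (hlam : ∀ i : Fin (2 * r), br τ (lamAt twoL η lam₀ i) ≠ 0)
    (c : Fin (twoL + 1) → Fin (2 * r) → ℂ) (u : ℂ) :
    ∃ B : Matrix (Fin (2 * r)) (Fin (2 * r)) ((Fin (twoL + 1) → ℂ) →ₗ[ℂ] thetaSpace twoL τ),
      (sandwich (gaugeBlock twoL r η τ lam₀ v)⁻¹
          (tensorMat (lOp twoL η τ u) (sMatrix twoL r η τ lam₀ v c u))
          (gaugeBlock twoL r η τ lam₀ v)).submatrix blockIndex blockIndex =
        Matrix.fromBlocks
          ((2 * br τ (u + twoL * η)) • sMatrix twoL r η τ lam₀ v c (u - 2 * η)) B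
          0
          (sandwich (xMatrix twoL r η τ lam₀)⁻¹
            ((2 * br τ (u - twoL * η)) • sMatrix twoL r η τ lam₀ v c (u + 2 * η))
            (xMatrix twoL r η τ lam₀)) := by
  have hv' : br τ (-v) ≠ 0 := by rwa [br_neg, neg_ne_zero]
  have hper : ∀ {x y : ℂ} {m : ℤ}, x = y + m * 2 → br τ y = br τ x := fun h ↦ by
    rw [h, br_periodic.int_mul]
  have hlam' : ∀ i : Fin (2 * r), br τ (-lamAt twoL η lam₀ i) ≠ 0 := fun i ↦ by
    rw [br_neg, neg_ne_zero]
    exact hlam i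
  -- Nothing is claimed about the upper right block, so it is read off from the matrix itself.
  refine ⟨Matrix.of fun i j ↦ sandwich (gaugeBlock twoL r η τ lam₀ v)⁻¹
    (tensorMat (lOp twoL η τ u) (sMatrix twoL r η τ lam₀ v c u))
    (gaugeBlock twoL r η τ lam₀ v) (0, i) (1, j), ?_⟩
  ext1 x y
  rcases x with i | i <;> rcases y with j | j
  · refine (sandwich_gaugeBlock_apply hv hlam u _ 0 0 i j).trans ?_
    rw [Matrix.fromBlocks_apply₁₁]
    refine gaugedEnd_comp_sMatrix hη' c u _ (fun m hm ↦ ?_) fun m hm ↦ ?_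
    · exact gauged_zero_zero hη rfl hv (by rw [hper hm]; exact hlam i) u
    · exact gauged_zero_zero hη rfl hv' (by rw [hper hm]; exact hlam' i) u
  · rfl
  · refine (sandwich_gaugeBlock_apply hv hlam u _ 1 0 i j).trans ?_
    rw [Matrix.fromBlocks_apply₂₁,
      gaugedEnd_comp_sMatrix hη' c u u (k := 0) (fun m hm ↦ ?_) fun m hm ↦ ?_, zero_smul, Matrix.zero_apply]
    · rw [zero_smul]
      exact gauged_one_zero hη rfl u
    · rw [zero_smul]
      exact gauged_one_zero hη rfl u
  · refine (sandwich_gaugeBlock_apply hv hlam u _ 1 1 i j).trans ?_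
    rw [Matrix.fromBlocks_apply₂₂, Matrix.inv_eq_right_inv (xMatrix_inv hlam), xMatrix,
      sandwich_diagonal_apply, Matrix.smul_apply, smul_smul]
    refine gaugedEnd_comp_sMatrix hη' c u _ (fun m hm ↦ ?_) fun m hm ↦ ?_
    · have h := hper hm
      rw [gauged_one_one hη rfl hv (by rw [h]; exact hlam i) u, h]
    · have h := hper hm
      -- For the negated parameters the ratio [-λ_j]/[-λ_i] equals [λ_j]/[λ_i], so both directions
      -- give the same conjugation by X.
      rw [gauged_one_one hη rfl hv' (by rw [h]; exact hlam' i) u, h, br_neg, br_neg, inv_neg,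
        neg_mul_neg]

end Gauge

lemma bijective_blockIndex {J : Type*} : Function.Bijective (blockIndex (I := J)) := by
  constructor
  · rintro (i | i) (j | j) h <;> simp_all [blockIndex]
  · rintro ⟨a, i⟩
    fin_cases a
    · exact ⟨.inl i, rfl⟩
    · exact ⟨.inr i, rfl⟩

end Sklyanin
end

/-! ### Block triangularity and the TQ-relation -/

theorem mainTheorem5
    (τ : UpperHalfPlane) (hτ : τ.re = 0)
    (twoL N r : ℕ) (hl : 0 < twoL) (hN : 0 < N) (hNeven : Even N) (hr : 0 < r)
    (r' : ℤ) (η : ℝ) (hη : η = r' / (twoL * r)) (hη0 : η ≠ 0)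
    (hηle : |η| ≤ 1 / (2 * (twoL + 1)))
    (lam₀ v : ℂ) (hv : br τ v ≠ 0)
    (hlam : ∀ i : Fin (2 * r), br τ (lamAt twoL η lam₀ i) ≠ 0)
    (c : Fin (twoL + 1) → Fin (2 * r) → ℂ) (u : ℂ) :
    IsUnit (gaugeBlock twoL r η τ lam₀ v) ∧
    (∃ B : Matrix (Fin (2 * r)) (Fin (2 * r)) ((Fin (twoL + 1) → ℂ) →ₗ[ℂ] thetaSpace twoL τ),
      (sandwich (gaugeBlock twoL r η τ lam₀ v)⁻¹
          (tensorMat (lOp twoL η τ u) (sMatrix twoL r η τ lam₀ v c u))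
          (gaugeBlock twoL r η τ lam₀ v)).submatrix blockIndex blockIndex =
        Matrix.fromBlocks
          ((2 * br τ (u + twoL * η)) • sMatrix twoL r η τ lam₀ v c (u - 2 * η)) B
          0
          (sandwich (xMatrix twoL r η τ lam₀)⁻¹
            ((2 * br τ (u - twoL * η)) • sMatrix twoL r η τ lam₀ v c (u + 2 * η))
            (xMatrix twoL r η τ lam₀))) ∧
    transferMatrix N twoL η τ u ∘ₗ qR N twoL r η τ lam₀ v c u =
      hMinus N twoL η τ u • qR N twoL r η τ lam₀ v c (u - 2 * η) +
      hPlus N twoL η τ u • qR N twoL r η τ lam₀ v c (u + 2 * η) := by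
  have hl' : (0 : ℝ) < twoL := by exact_mod_cast hl
  have hr' : (0 : ℝ) < r := by exact_mod_cast hr
  have hηr : (twoL : ℂ) * r * (η : ℂ) = r' := by
    have h : (twoL : ℝ) * r * η = r' := by
      rw [hη]
      field_simp
    exact_mod_cast h
  -- The bound 1/(2(2l+1)) is below 1/2 because 2l > 0.
  have hη2 : |η| < 1 / 2 :=
    hηle.trans_lt (one_div_lt_one_div_of_lt two_pos (by linarith))
  have hθ := thetaIdx_ne_zero τ hη0 hη2
  have hU := isUnit_gaugeBlock hv hlam
  have hblock := sandwich_gaugeBlock_eq hηr hθ hv hlam c u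
  refine ⟨hU, hblock, ?_⟩
  obtain ⟨B, hB⟩ := hblock
  have hinv := Matrix.mul_nonsing_inv _ ((Matrix.isUnit_iff_isUnit_det _).1 hU)
  have hX := xMatrix_inv (τ := τ) (twoL := twoL) (η := η) (lam₀ := lam₀) hlam
  have hX' : xMatrix twoL r η τ lam₀ * (xMatrix twoL r η τ lam₀)⁻¹ = 1 := by
    rw [Matrix.inv_eq_right_inv hX, hX]
  -- The trace of the conjugated L ⊗ S is evaluated twice: through its triangular block form, where
  -- X also drops out, and by undoing the conjugation, which leaves T(u) composed with Q_R(u).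
  have hsub := siteTrace_submatrix N (Equiv.ofBijective _ bijective_blockIndex)
    (sandwich (gaugeBlock twoL r η τ lam₀ v)⁻¹
      (tensorMat (lOp twoL η τ u) (sMatrix twoL r η τ lam₀ v c u)) (gaugeBlock twoL r η τ lam₀ v))
  rw [Equiv.coe_ofBijective, hB, siteTrace_fromBlocks hN, siteTrace_sandwich N hX',
    siteTrace_sandwich N hinv, siteTrace_smul, siteTrace_smul, ← siteTrace_comp] at hsub
  rw [transferMatrix_eq hN, qR, ← hsub]
  rfl
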